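/- Let $N_1,N_2\ge 2$ and consider the torus lattice with identifications $j\sim j+N_1$, $n\sim n+N_2$, carrying a matter qubit at each $(n,j)$ and a gauge qubit at each $(n+\tfrac12,j+\tfrac12)$, hence $N=2N_1N_2$ qubits. Write $X_a,Z_a$ for the Pauli operators at site $a$, $|0\rangle$ for the state with $Z=1$, $S=\mathrm{diag}(1,i)$, $\mathrm{CZ}_{ab}$, $\mathrm{CS}_{ab}$, $\mathrm{CCZ}_{abc}$ for the controlled gates, and $\mathrm{CZ}_{aa}=Z_a$ when two sites of a gate are identified. Define $$S^M_{n,j+1/2}=Z_{n,j}Z_{n,j+1}Z_{n-1/2,j+1/2}Z_{n+1/2,j+1/2}$$ and $$S^E_{n+1/2,j}=-X_{n,j}X_{n+1,j}X_{n+1/2,j-1/2}X_{n+1/2,j+1/2}\cdot D,$$ where $D$ is the product of the following gates: $S^\dagger$ on $(n,j-1)$, $(n,j)$, $(n+1,j)$, $(n+1,j+1)$, $(n+\frac12,j-\frac12)$, $(n+\frac12,j+\frac12)$; $Z$ on $(n,j+1)$, $(n+1,j-1)$; $\mathrm{CZ}$ on the pairs $(n,j)(n,j+1)$, $(n,j-1)(n+1,j-1)$,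 $(n,j-1)(n+1,j)$, $(n,j)(n+1,j-1)$, $(n,j)(n+1,j+1)$, $(n,j+1)(n+1,j)$, $(n,j+1)(n+1,j+1)$, $(n+1,j-1)(n+1,j)$; and, for each $k\in\{j-1,j\}$, $\mathrm{CZ}$ between $(n+\frac32,k+\frac12)$ and each of $(n,k)$, $(n,k+1)$, $(n+1,k)$, $(n+1,k+1)$, $(n+2,k)$, $(n+2,k+1)$, $(n+\frac52,k+\frac12)$. 1. (Origin of the stabilizers; $N_1\ge3$, $N_2\ge4$.) These are the operators obtained by layered gauging of the Levin–Gu symmetries $U_n=-\prod_jX_{n,j}\prod_jL_{(n,j),(n,j+1)}$, $L_{a,b}=i^{(1-Z_aZ_b)/2}$. In detail, let $M_{n,n+1}$ be the product of $\mathrm{CCZ}$ over the triangles $\{(n,j),(n,j+1),(n+1,j)\}$ and $\{(n+1,j+1),(n,j+1),(n+1,j)\}$ for all $j$, and let $\Xi_{n,n+1}$ be the product of $M_{n,n+1}$ with $\mathrm{CCZ}$ on $(n-1,j),(n-\frac12,j+\frac12),(n,j+1)$ and $\mathrm{CS}$ on $[(n-1,j),(n-\frac12,j+\frac12)]$ and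 on $[(n,j+1),(n-\frac12,j+\frac12)]$ for all $j$. Let $G_{n,j}=X_{n,j}X_{n+1,j}X_{n+1/2,j-1/2}X_{n+1/2,j+1/2}$. For an operator $O$ near column $j$, its gauged form for the layers $n,n+1$ is an operator $O'$ that commutes with all $G_{n,i}$, agrees with $O$ on all $Z$-basis states in which the gauge qubits at height $n+\frac12$ are all $|0\rangle$, and acts trivially on every site at horizontal distance more than $1$ from column $j$. (a) $M_{n,n+1}U_nU_{n+1}M_{n,n+1}=\prod_jX_{n,j}X_{n+1,j}$. Let $$V_{n+1}=-\prod_jX_{n+1,j}\prod_j i^{(1-Z_{n,j}Z_{n+1/2,j+1/2}Z_{n,j+1})/2}\,i^{(1-Z_{n+1,j}Z_{n+1/2,j+1/2}Z_{n+1,j+1})/2}\,i^{(1-Z_{n+1,j}Z_{n+1/2,j+1/2}Z_{n,j+1})/2}\,L^\dagger_{(n,j),(n+1,j)}.$$ Then $V_{n+1}$ commutes with all $G_{n,j}$ and agrees with $M_{n,n+1}U_{n+1}M_{n,n+1}$ when the gauge qubits at height $n+\frac12$ are all $|0\rangle$. With $U'_{n+1}=M_{n,n+1}V_{n+1}M_{n,n+1}$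 one has $\Xi_{n+1,n+2}U'_{n+1}U_{n+2}\Xi_{n+1,n+2}^\dagger=\prod_jX_{n+1,j}X_{n+2,j}$ and $\Xi_{n+1,n+2}U_{n+2}\Xi_{n+1,n+2}^\dagger=M_{n+1,n+2}U_{n+2}M_{n+1,n+2}$. (b) Let a gauging step for layers $n,n+1$ consist of conjugating an operator by $\Xi_{n,n+1}$ ($O\mapsto\Xi O\Xi^\dagger$), passing to its gauged form, and conjugating by $M_{n,n+1}$. For $r\ge2$ with $r+2\le N_2$, the gauging steps for the layer pairs $(n+1,n+2),\dots,(n+r,n+r+1)$ turn $M_{n,n+1}G_{n,j}M_{n,n+1}$ into $S^E_{n+1/2,j}$ and into no other operator. For $r\ge2$ with $r+1\le N_2$, the gauging steps for the layer pairs $(n-1,n),\dots,(n+r-2,n+r-1)$ turn the Ising term $Z_{n,j}Z_{n,j+1}$ into $S^M_{n,j+1/2}$ and into no other operator. 2. All $S^E$ and $S^M$ are Hermitian with square $1$, and they all commute with each other. 3. $\prod_{n,j}S^E_{n+1/2,j}=1$. 4. (No frustration.) On the space of states with $S^E_{n+1/2,j}=1$ for all $n,j$, the Hamiltonian $\tilde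 H=-\sum_{n,j}S^M_{n,j+1/2}$ has smallest eigenvalue $-N_1N_2$, and its ground states are exactly the states satisfying all constraints $S^E=1$ and $S^M=1$. On the full Hilbert space, $H=-\sum_{n,j}(S^E_{n+1/2,j}+S^M_{n,j+1/2})$ has smallest eigenvalue $-2N_1N_2$ and the same ground states. 5. (Degeneracy.) The space of ground states has dimension exactly $4$. For any fixed $n_0,j_0$, the four states $$\prod_{n,j}\frac{1+S^E_{n+1/2,j}}2\Big(\prod_jX_{n_0,j}\Big)^x\Big(\prod_nX_{n+1/2,j_0+1/2}\Big)^y|0\rangle^{\otimes N},\qquad x,y\in\{0,1\},$$ labelled by the non-contractible loops, form a basis of it. 6. (Gap.) Every other eigenvalue of $\tilde H$ on the space $\{S^E=1\}$, and every other eigenvalue of $H$, exceeds the ground-state energy by at least $2$, whatever $N_1,N_2$. -/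

import Mathlib

open scoped BigOperators

noncomputable section

namespace DoubleSemion

/-- Qubits of the `N1 × N2` torus (`j ∼ j + N1` horizontally, `n ∼ n + N2` in the layering
direction). `Sum.inl (n, j)` is the matter qubit at `(n, j)`, and `Sum.inr (n, j)` is the gauge
qubit at `(n + 1/2, j + 1/2)`. -/
abbrev Site (N1 N2 : ℕ) : Type := (ZMod N2 × ZMod N1) ⊕ (ZMod N2 × ZMod N1)

/-- The matter qubit at `(n, j)`. -/
abbrev vtx {N1 N2 : ℕ} (n : ZMod N2) (j : ZMod N1) : Site N1 N2 := Sum.inl (n, j)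

/-- The gauge qubit at `(n + 1/2, j + 1/2)`. -/
abbrev lnk {N1 N2 : ℕ} (n : ZMod N2) (j : ZMod N1) : Site N1 N2 := Sum.inr (n, j)

/-- `Z`-basis configurations: the value `0` at a site is the state with `Z = 1`, the value `1`
is the state with `Z = -1`. -/
abbrev Config (N1 N2 : ℕ) : Type := Site N1 N2 → ZMod 2

/-- The Hilbert space of `2 * N1 * N2` qubits, with its orthonormal `Z`-basis. -/
abbrev Hilb (N1 N2 : ℕ) [NeZero N1] [NeZero N2] : Type := EuclideanSpace ℂ (Config N1 N2)

/-- Linear operators on the Hilbert space. -/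
abbrev Op (N1 N2 : ℕ) [NeZero N1] [NeZero N2] : Type := Module.End ℂ (Hilb N1 N2)

variable {N1 N2 : ℕ} [NeZero N1] [NeZero N2]

/-- The `Z`-basis state of a configuration. -/
def ket (z : Config N1 N2) : Hilb N1 N2 := EuclideanSpace.single z 1

/-- The product of the Pauli operators `X` over the sites `a` with `s a = 1`; it maps `ket z` to
`ket (z + s)`. -/
def flipX (s : Config N1 N2) : Op N1 N2 where
  toFun ψ := WithLp.toLp 2 fun z => ψ (z + s)
  map_add' _ _ := rfl
  map_smul' _ _ := rfl

/-- The diagonal unitary with `ket z ↦ i ^ (f z) • ket z`. -/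
def phase (f : Config N1 N2 → ZMod 4) : Op N1 N2 where
  toFun ψ := WithLp.toLp 2 fun z => Complex.I ^ (f z).val * ψ z
  map_add' ψ φ := by ext z; simp [mul_add]
  map_smul' c ψ := by ext z; simp [mul_left_comm]

/-- The value of a qubit as an exponent of `i`. Thus `phase` of `b z a`, of `2 * b z a`, of
`3 * b z a`, of `2 * b z a * b z c`, of `b z a * b z c` and of `2 * b z a * b z c * b z d` is the
gate `S` (`diag (1, i)`), `Z`, `S†`, `CZ`, `CS` and `CCZ`. A sum of exponents is a product of
diagonal gates. If the two sites of a `CZ` are identified, it becomes `Z`. -/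
def b (z : Config N1 N2) (a : Site N1 N2) : ZMod 4 := ((z a).val : ZMod 4)

/-- The configuration with a single `1`. -/
abbrev e (a : Site N1 N2) : Config N1 N2 := Pi.single a 1

/-- Pauli `X` on a site. -/
def pauliX (a : Site N1 N2) : Op N1 N2 := flipX (e a)

/-- Pauli `Z` on a site. -/
def pauliZ (a : Site N1 N2) : Op N1 N2 := phase fun z => 2 * b z a

/-! ### The stabilizers -/

/-- The stabilizer `S^E` centred at `(n + 1/2, j)`: a sign and four Pauli `X` on the left, and
gates `S†`, `Z`, `CZ` on the right. -/
def SE (n : ZMod N2) (j : ZMod N1) : Op N1 N2 :=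
  flipX (e (vtx n j) + e (vtx (n + 1) j) + e (lnk n (j - 1)) + e (lnk n j)) *
  phase fun z =>
    2
    + 3 * (b z (vtx n (j - 1)) + b z (vtx n j) + b z (vtx (n + 1) j) + b z (vtx (n + 1) (j + 1))
      + b z (lnk n (j - 1)) + b z (lnk n j))
    + 2 * (b z (vtx n (j + 1)) + b z (vtx (n + 1) (j - 1)))
    + 2 * (b z (vtx n j) * b z (vtx n (j + 1))
      + b z (vtx n (j - 1)) * b z (vtx (n + 1) (j - 1))
      + b z (vtx n (j - 1)) * b z (vtx (n + 1) j)
      + b z (vtx n j) * b z (vtx (n + 1) (j - 1))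
      + b z (vtx n j) * b z (vtx (n + 1) (j + 1))
      + b z (vtx n (j + 1)) * b z (vtx (n + 1) j)
      + b z (vtx n (j + 1)) * b z (vtx (n + 1) (j + 1))
      + b z (vtx (n + 1) (j - 1)) * b z (vtx (n + 1) j)
      + b z (lnk (n + 1) (j - 1)) * (b z (vtx n (j - 1)) + b z (vtx n j)
        + b z (vtx (n + 1) (j - 1)) + b z (vtx (n + 1) j)
        + b z (vtx (n + 2) (j - 1)) + b z (vtx (n + 2) j) + b z (lnk (n + 2) (j - 1)))
      + b z (lnk (n + 1) j) * (b z (vtx n j) + b z (vtx n (j + 1))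
        + b z (vtx (n + 1) j) + b z (vtx (n + 1) (j + 1))
        + b z (vtx (n + 2) j) + b z (vtx (n + 2) (j + 1)) + b z (lnk (n + 2) j)))

/-- The stabilizer `S^M` centred at `(n, j + 1/2)`: a product of four Pauli `Z`. -/
def SM (n : ZMod N2) (j : ZMod N1) : Op N1 N2 :=
  pauliZ (vtx n j) * pauliZ (vtx n (j + 1)) * pauliZ (lnk (n - 1) j) * pauliZ (lnk n j)

/-! ### Layered gauging of the Levin-Gu symmetry -/

/-- The product of `X` over layer `n`. -/
def rowX (n : ZMod N2) : Op N1 N2 := flipX (∑ j : ZMod N1, e (vtx n j))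

/-- Exponent of `L_{a,c} = i ^ ((1 - Z_a Z_c) / 2)`. -/
def lExp (z : Config N1 N2) (a c : Site N1 N2) : ZMod 4 := ((z a + z c).val : ZMod 4)

/-- Exponent of `i ^ ((1 - Z_a Z_c Z_d) / 2)`, the gauged form of `L`. -/
def lExp3 (z : Config N1 N2) (a c d : Site N1 N2) : ZMod 4 := ((z a + z c + z d).val : ZMod 4)

/-- The Levin-Gu symmetry `U_n = - ∏ X ∏ L` of layer `n`. -/
def levinGu (n : ZMod N2) : Op N1 N2 :=
  -(rowX n * phase fun z => ∑ j : ZMod N1, lExp z (vtx n j) (vtx n (j + 1)))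

/-- Exponent of `M_{n,n+1}`: `CCZ` on every lower-left and every upper-right triangle between
layers `n` and `n + 1`. -/
def mExp (n : ZMod N2) (z : Config N1 N2) : ZMod 4 :=
  ∑ j : ZMod N1,
    (2 * b z (vtx n j) * b z (vtx n (j + 1)) * b z (vtx (n + 1) j)
      + 2 * b z (vtx (n + 1) (j + 1)) * b z (vtx n (j + 1)) * b z (vtx (n + 1) j))

/-- `M_{n,n+1}`. -/
def mGate (n : ZMod N2) : Op N1 N2 := phase (mExp n)

/-- Exponent of `Ξ_{n,n+1}`: that of `M_{n,n+1}`, together with `CCZ` on `(n - 1, j)`,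
`(n - 1/2, j + 1/2)`, `(n, j + 1)` and `CS` on `(n - 1, j)`, `(n - 1/2, j + 1/2)` and on
`(n, j + 1)`, `(n - 1/2, j + 1/2)`, for all `j`. -/
def xiExp (n : ZMod N2) (z : Config N1 N2) : ZMod 4 :=
  mExp n z + ∑ j : ZMod N1,
    (2 * b z (vtx (n - 1) j) * b z (lnk (n - 1) j) * b z (vtx n (j + 1))
      + b z (vtx (n - 1) j) * b z (lnk (n - 1) j)
      + b z (vtx n (j + 1)) * b z (lnk (n - 1) j))

/-- `Ξ_{n,n+1}`. -/
def xiGate (n : ZMod N2) : Op N1 N2 := phase (xiExp n)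

/-- `Ξ_{n,n+1}†`. -/
def xiGateInv (n : ZMod N2) : Op N1 N2 := phase fun z => -xiExp n z

/-- The Gauss law operator at column `j` that appears when the onsite symmetry
`∏ X_{n,j} X_{n+1,j}` is gauged. -/
def gauss (n : ZMod N2) (j : ZMod N1) : Op N1 N2 :=
  pauliX (vtx n j) * pauliX (vtx (n + 1) j) * pauliX (lnk n (j - 1)) * pauliX (lnk n j)

/-- Sites whose horizontal distance to column `j` is at most `1`. -/
def Near (j : ZMod N1) : Site N1 N2 → Prop
  | Sum.inl (_, i) => i = j - 1 ∨ i = j ∨ i = j + 1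
  | Sum.inr (_, i) => i = j - 1 ∨ i = j

/-- `O'` is the gauged form of the operator `O` (local around column `j`) for the onsite symmetry
`∏ X_{n,j} X_{n+1,j}`: it commutes with the Gauss law operators, it agrees with `O` when the gauge
qubits between layers `n` and `n + 1` are trivial, and it is local around column `j`. -/
def IsGauged (n : ZMod N2) (j : ZMod N1) (O O' : Op N1 N2) : Prop :=
  (∀ i, Commute O' (gauss n i)) ∧
  (∀ z : Config N1 N2, (∀ i, z (lnk n i) = 0) → O' (ket z) = O (ket z)) ∧
  ∀ a : Site N1 N2, ¬ Near j a → Commute O' (pauliX a) ∧ Commute O' (pauliZ a)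

/-- One step of layered gauging, for layers `n` and `n + 1`: conjugate by `Ξ_{n,n+1}`, gauge,
conjugate by `M_{n,n+1}`. -/
def GaugingStep (n : ZMod N2) (j : ZMod N1) (O O' : Op N1 N2) : Prop :=
  ∃ O₁ : Op N1 N2, IsGauged n j (xiGate n * O * xiGateInv n) O₁ ∧ O' = mGate n * O₁ * mGate n

/-- `O'` results from `O` by the `r` consecutive steps for the pairs of layers
`(n, n + 1), …, (n + r - 1, n + r)`. -/
def LayeredGauging (n : ZMod N2) (j : ZMod N1) (O : Op N1 N2) : ℕ → Op N1 N2 → Prop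
  | 0, O' => O' = O
  | r + 1, O' => ∃ O₁ : Op N1 N2, LayeredGauging n j O r O₁ ∧ GaugingStep (n + (r : ZMod N2)) j O₁ O'

/-- `V_{n+1}`: the operator `M_{n,n+1} U_{n+1} M_{n,n+1}`, a product of `-1`, of `X` over layer
`n + 1` and of `L` or `L†` over the bonds between and in layers `n` and `n + 1`, with each `L`
coupled to the gauge field. -/
def gaugedU (n : ZMod N2) : Op N1 N2 :=
  -(rowX (n + 1) * phase fun z => ∑ j : ZMod N1,
    (lExp3 z (vtx n j) (lnk n j) (vtx n (j + 1))
      + lExp3 z (vtx (n + 1) j) (lnk n j) (vtx (n + 1) (j + 1))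
      + lExp3 z (vtx (n + 1) j) (lnk n j) (vtx n (j + 1))
      - lExp z (vtx n j) (vtx (n + 1) j)))

/-- `U'_{n+1} = M_{n,n+1} V_{n+1} M_{n,n+1}`. -/
def dressedU (n : ZMod N2) : Op N1 N2 := mGate n * gaugedU n * mGate n

/-! ### The model and its ground states -/

/-- The product of a family of operators over all positions. (It is used for commuting families,
for which the order is irrelevant.) -/
def prodAll (F : ZMod N2 → ZMod N1 → Op N1 N2) : Op N1 N2 :=
  ((Finset.univ : Finset (ZMod N2 × ZMod N1)).toList.map fun p => F p.1 p.2).prod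

/-- States that satisfy all constraints `S^E = 1`. -/
def gaussSpace (N1 N2 : ℕ) [NeZero N1] [NeZero N2] : Submodule ℂ (Hilb N1 N2) :=
  ⨅ (n : ZMod N2) (j : ZMod N1), LinearMap.ker (SE n j - 1)

/-- States that satisfy all stabilizers, `S^E = 1` and `S^M = 1`. -/
def stabSpace (N1 N2 : ℕ) [NeZero N1] [NeZero N2] : Submodule ℂ (Hilb N1 N2) :=
  gaussSpace N1 N2 ⊓ ⨅ (n : ZMod N2) (j : ZMod N1), LinearMap.ker (SM n j - 1)

/-- The Hamiltonian `- ∑ S^M` of the theory in which `S^E = 1` is a constraint. -/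
def hamTilde (N1 N2 : ℕ) [NeZero N1] [NeZero N2] : Op N1 N2 :=
  -∑ n : ZMod N2, ∑ j : ZMod N1, SM n j

/-- The Hamiltonian `- ∑ (S^E + S^M)` of the theory without constraints. -/
def ham (N1 N2 : ℕ) [NeZero N1] [NeZero N2] : Op N1 N2 :=
  -∑ n : ZMod N2, ∑ j : ZMod N1, (SE n j + SM n j)

/-- The energies (eigenvalues) of `H` on the space `P` of allowed states. -/
def energies (H : Op N1 N2) (P : Submodule ℂ (Hilb N1 N2)) : Set ℝ :=
  {E | ∃ ψ ∈ P, ψ ≠ 0 ∧ H ψ = (E : ℂ) • ψ}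

/-- The space of states in `P` of energy `E`. -/
def energySpace (H : Op N1 N2) (P : Submodule ℂ (Hilb N1 N2)) (E : ℝ) :
    Submodule ℂ (Hilb N1 N2) :=
  P ⊓ Module.End.eigenspace H (E : ℂ)

/-- The configuration of non-contractible loops
`(∏_j X_{n₀,j}) ^ x (∏_n X_{n+1/2,j₀+1/2}) ^ y |0…0⟩`. -/
def loopConfig (n₀ : ZMod N2) (j₀ : ZMod N1) (x y : ZMod 2) : Config N1 N2 :=
  x • (∑ j : ZMod N1, e (vtx n₀ j)) + y • ∑ n : ZMod N2, e (lnk n j₀)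

/-- The projection `∏ (1 + S^E) / 2` of a loop configuration. -/
def loopState (n₀ : ZMod N2) (j₀ : ZMod N1) (p : ZMod 2 × ZMod 2) : Hilb N1 N2 :=
  prodAll (fun n j => (2⁻¹ : ℂ) • (1 + SE n j)) (ket (loopConfig n₀ j₀ p.1 p.2))

end DoubleSemion

end

open DoubleSemion

set_option linter.unusedSectionVars false

namespace DoubleSemion

variable {N1 N2 : ℕ}

/-! ### Bits -/

/-! Every operator here is monomial in the `Z`-basis: `mono s f` sends `ket z` to `i ^ f z • ket (z
+ s)`. By the composition rule `mono_mul`, operator identities become identities between `ZMod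
4`-valued functions of configurations. The exponent of $S^E$ is quadratic, so a flip changes it by a
polar form (`expE_add`).

Commutation and squares are settled for all tori at once. Sites are kept as integer displacements
from a base point, and the torus enters only through indicators that two base points differ by a
given displacement. What remains are finite parity checks on the infinite lattice
(`polar_flipE_symm`, `expE_flipE_symm`, `polar_flipE_self`).

Multiplying the $S^E$ of a row column by column, the phases telescope to $U_nU_{n+1}$
(`map_prod_row`). The $U_n$ are commuting involutions and each occurs in two rows, so the total
product is $1$.

The flips of the $S^E$ are boundaries and the $S^M$ test closedness, so the ground states are
governed by the homology of the torus over $\mathbb Z/2$. The only relation among the flips is the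
total one (`sum_flipE_eq_zero`); as the corresponding product of operators is $+1$, projected basis
states do not vanish (`projE_ket_self`). This leaves one ground state per homology class, hence
four. Energies are sums of signs of commuting involutions, and each violated stabilizer costs $2$
(`eigenvalue_of_sum`).

A gauged form is unique (`IsGauged.unique`), so each gauging step only needs one to be exhibited.
The variation of the `CCZ` gates of $M$ produces the Levin–Gu phases, and the additional gates of
$\Xi$ cancel the gauge-field phases of $U'_{n+1}$. The Gauss operator collects all phases of $S^E$
in two steps; the Ising term becomes $S^M$ in two steps. Later steps change neither. -/

lemma config_add_self (s : Config N1 N2) : s + s = 0 := by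
  ext a
  exact CharTwo.add_self_eq_zero _

lemma config_add_add_cancel (z s : Config N1 N2) : z + s + s = z := by
  rw [add_assoc, config_add_self, add_zero]

lemma b_eq_zero {z : Config N1 N2} {a : Site N1 N2} (h : z a = 0) : b z a = 0 := by
  simp [b, h]

lemma four_eq_zero : (4 : ZMod 4) = 0 := rfl

/-- Addition of bits lifts to the integers as $x+y-2xy$, and modulo 4 the sign of the last term is
immaterial. All polar forms below originate from this correction. -/
lemma val_cast_add (x y : ZMod 2) : (((x + y).val : ℕ) : ZMod 4) =
    (x.val : ZMod 4) + (y.val : ZMod 4) + 2 * (x.val : ZMod 4) * (y.val : ZMod 4) := by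
  revert x y; decide

lemma b_add (z s : Config N1 N2) (a : Site N1 N2) :
    b (z + s) a = b z a + b s a + 2 * b z a * b s a := val_cast_add _ _

lemma b_e (a c : Site N1 N2) : b (e a) c = if c = a then 1 else 0 := by
  unfold b
  rw [e, Pi.single_apply]
  split_ifs <;> rfl

lemma lExp_eq (z : Config N1 N2) (a c : Site N1 N2) :
    lExp z a c = b z a + b z c + 2 * b z a * b z c := val_cast_add _ _

lemma lExp3_eq (z : Config N1 N2) (a c d : Site N1 N2) :
    lExp3 z a c d = b z a + b z c + b z d + 2 * b z a * b z c + 2 * b z a * b z d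
      + 2 * b z c * b z d := by
  rw [lExp3, val_cast_add, val_cast_add]
  change b z a + b z c + 2 * b z a * b z c + b z d
    + 2 * (b z a + b z c + 2 * b z a * b z c) * b z d = _
  linear_combination (b z a * b z c * b z d) * four_eq_zero

variable [NeZero N1] [NeZero N2]

/-! ### Monomial operators -/

lemma I_pow_val_add (a c : ZMod 4) :
    Complex.I ^ (a + c).val = Complex.I ^ a.val * Complex.I ^ c.val := by
  rw [ZMod.val_add, ← pow_add, ← Complex.I_pow_eq_pow_mod]

@[simp] lemma flipX_apply (s : Config N1 N2) (ψ : Hilb N1 N2) (z : Config N1 N2) :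
    flipX s ψ z = ψ (z + s) := rfl

@[simp] lemma phase_apply (f : Config N1 N2 → ZMod 4) (ψ : Hilb N1 N2) (z : Config N1 N2) :
    phase f ψ z = Complex.I ^ (f z).val * ψ z := rfl

/-- The monomial operator `ket z ↦ i ^ (f z) • ket (z + s)`. -/
noncomputable def mono (s : Config N1 N2) (f : Config N1 N2 → ZMod 4) : Op N1 N2 :=
  flipX s * phase f

lemma mono_apply (s : Config N1 N2) (f : Config N1 N2 → ZMod 4) (ψ : Hilb N1 N2)
    (z : Config N1 N2) : mono s f ψ z = Complex.I ^ (f (z + s)).val * ψ (z + s) := rfl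

lemma op_ext {A B : Op N1 N2} (h : ∀ ψ z, A ψ z = B ψ z) : A = B := by
  ext1 ψ
  ext z
  exact h ψ z

lemma mono_mul (s t : Config N1 N2) (f g : Config N1 N2 → ZMod 4) :
    mono s f * mono t g = mono (s + t) fun z => g z + f (z + t) := by
  refine op_ext fun ψ z => ?_
  simp only [Module.End.mul_apply, mono_apply, I_pow_val_add]
  rw [← add_assoc z s t, config_add_add_cancel]
  ring

lemma flipX_eq_mono (s : Config N1 N2) : flipX s = mono s 0 := by
  refine op_ext fun ψ z => ?_
  simp [mono_apply]

lemma phase_eq_mono (f : Config N1 N2 → ZMod 4) : phase f = mono 0 f := by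
  refine op_ext fun ψ z => ?_
  simp [mono_apply]

lemma neg_mono (s : Config N1 N2) (f : Config N1 N2 → ZMod 4) :
    -mono s f = mono s fun z => 2 + f z := by
  refine op_ext fun ψ z => ?_
  have h2 : (2 : ZMod 4).val = 2 := rfl
  simp [mono_apply, I_pow_val_add, h2]

lemma mono_zero_zero : mono (0 : Config N1 N2) 0 = 1 := by
  refine op_ext fun ψ z => ?_
  simp [mono_apply]

lemma mono_congr {s t : Config N1 N2} {f g : Config N1 N2 → ZMod 4} (hs : s = t)
    (h : ∀ z, f z = g z) : mono s f = mono t g := by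
  rw [hs, funext h]

lemma mono_commute {s t : Config N1 N2} {f g : Config N1 N2 → ZMod 4}
    (h : ∀ z, g z + f (z + t) = f z + g (z + s)) : Commute (mono s f) (mono t g) := by
  rw [Commute, SemiconjBy, mono_mul, mono_mul]
  exact mono_congr (add_comm _ _) h

lemma ket_apply (z w : Config N1 N2) : ket z w = if w = z then 1 else 0 := by
  simp [ket]

lemma mono_ket (s : Config N1 N2) (f : Config N1 N2 → ZMod 4) (z : Config N1 N2) :
    mono s f (ket z) = Complex.I ^ (f z).val • ket (z + s) := by
  ext w
  rw [mono_apply, PiLp.smul_apply, ket_apply, ket_apply, smul_eq_mul]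
  by_cases h : w = z + s
  · subst h
    rw [config_add_add_cancel, if_pos rfl, if_pos rfl]
  · rw [if_neg h, if_neg, mul_zero, mul_zero]
    rintro rfl
    exact h (config_add_add_cancel _ _).symm

lemma ket_ext {A B : Op N1 N2} (h : ∀ z, A (ket z) = B (ket z)) : A = B := by
  refine (EuclideanSpace.basisFun (Config N1 N2) ℂ).toBasis.ext fun z => ?_
  simpa [ket] using h z

lemma inner_mono (s : Config N1 N2) (f : Config N1 N2 → ZMod 4) (ψ φ : Hilb N1 N2) :
    inner ℂ (mono s f ψ) (mono s f φ) = inner ℂ ψ φ := by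
  rw [PiLp.inner_apply, PiLp.inner_apply]
  refine Fintype.sum_equiv (Equiv.addRight s) _ _ fun z => ?_
  simp only [mono_apply, Equiv.coe_addRight, RCLike.inner_apply, map_mul, map_pow,
    Complex.conj_I]
  have h : Complex.I ^ (f (z + s)).val * (-Complex.I) ^ (f (z + s)).val = 1 := by
    rw [← mul_pow]; simp
  linear_combination (φ (z + s) * (starRingEnd ℂ) (ψ (z + s))) * h

/-- Monomial operators preserve the inner product, and an inner-product preserving involution is its
own adjoint. -/
lemma mono_isSymmetric {s : Config N1 N2} {f : Config N1 N2 → ZMod 4}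
    (h : mono s f ^ 2 = 1) : (mono s f).IsSymmetric := by
  intro ψ φ
  have h' : φ = mono s f (mono s f φ) := by
    rw [← Module.End.mul_apply, ← pow_two, h, Module.End.one_apply]
  conv_lhs => rw [h', inner_mono]

/-! ### Quadratic exponents on the universal cover -/

/-- A site of the infinite lattice, relative to a base point: `(true, a, c)` is the matter qubit
and `(false, a, c)` the gauge qubit displaced by `a` layers and `c` columns. -/
abbrev RelSite : Type := Bool × ℤ × ℤ

variable {N1 N2 : ℕ}

/-- The site of the torus displaced by `x` from the base point `(n, j)`. -/
def site (n : ZMod N2) (j : ZMod N1) : RelSite → Site N1 N2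
  | (true, a, c) => vtx (n + a) (j + c)
  | (false, a, c) => lnk (n + a) (j + c)

/-- The sites on which `S^E` has a gate `S†`. -/
def oddSites : List RelSite :=
  [(true, 0, -1), (true, 0, 0), (true, 1, 0), (true, 1, 1), (false, 0, -1), (false, 0, 0)]

/-- The sites on which `S^E` has a gate `Z`. -/
def evenSites : List RelSite := [(true, 0, 1), (true, 1, -1)]

/-- The pairs of sites on which `S^E` has a gate `CZ`. -/
def czPairs : List (RelSite × RelSite) :=
  [((true, 0, 0), (true, 0, 1)), ((true, 0, -1), (true, 1, -1)), ((true, 0, -1), (true, 1, 0)),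
    ((true, 0, 0), (true, 1, -1)), ((true, 0, 0), (true, 1, 1)), ((true, 0, 1), (true, 1, 0)),
    ((true, 0, 1), (true, 1, 1)), ((true, 1, -1), (true, 1, 0))] ++
  [-1, 0].flatMap fun k => [(true, 0, k), (true, 0, k + 1), (true, 1, k), (true, 1, k + 1),
    (true, 2, k), (true, 2, k + 1), (false, 2, k)].map fun x => ((false, 1, k), x)

/-- The sites on which `S^E` has a Pauli `X`. -/
def flipSites : List RelSite := [(true, 0, 0), (true, 1, 0), (false, 0, -1), (false, 0, 0)]

/-- The exponent of `S^E` for given values of the qubits. -/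
def exponent (h : RelSite → ZMod 4) : ZMod 4 :=
  2 + 3 * (oddSites.map h).sum + 2 * (evenSites.map h).sum
    + 2 * (czPairs.map fun x => h x.1 * h x.2).sum

/-- The pairs of sites that occur in the polar form of `exponent`. -/
def polarPairs : List (RelSite × RelSite) :=
  (oddSites.map fun x => (x, x)) ++ czPairs ++ czPairs.map Prod.swap

/-- The configuration of the Pauli `X` in `S^E`. -/
def flipE (n : ZMod N2) (j : ZMod N1) : Config N1 N2 :=
  e (vtx n j) + e (vtx (n + 1) j) + e (lnk n (j - 1)) + e (lnk n j)

/-- The exponent of `i` in `S^E`. -/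
def expE (n : ZMod N2) (j : ZMod N1) (z : Config N1 N2) : ZMod 4 :=
  exponent fun x => b z (site n j x)

lemma expE_eq (n : ZMod N2) (j : ZMod N1) (z : Config N1 N2) : expE n j z =
    2
    + 3 * (b z (vtx n (j - 1)) + b z (vtx n j) + b z (vtx (n + 1) j) + b z (vtx (n + 1) (j + 1))
      + b z (lnk n (j - 1)) + b z (lnk n j))
    + 2 * (b z (vtx n (j + 1)) + b z (vtx (n + 1) (j - 1)))
    + 2 * (b z (vtx n j) * b z (vtx n (j + 1))
      + b z (vtx n (j - 1)) * b z (vtx (n + 1) (j - 1))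
      + b z (vtx n (j - 1)) * b z (vtx (n + 1) j)
      + b z (vtx n j) * b z (vtx (n + 1) (j - 1))
      + b z (vtx n j) * b z (vtx (n + 1) (j + 1))
      + b z (vtx n (j + 1)) * b z (vtx (n + 1) j)
      + b z (vtx n (j + 1)) * b z (vtx (n + 1) (j + 1))
      + b z (vtx (n + 1) (j - 1)) * b z (vtx (n + 1) j)
      + b z (lnk (n + 1) (j - 1)) * (b z (vtx n (j - 1)) + b z (vtx n j)
        + b z (vtx (n + 1) (j - 1)) + b z (vtx (n + 1) j)
        + b z (vtx (n + 2) (j - 1)) + b z (vtx (n + 2) j) + b z (lnk (n + 2) (j - 1)))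
      + b z (lnk (n + 1) j) * (b z (vtx n j) + b z (vtx n (j + 1))
        + b z (vtx (n + 1) j) + b z (vtx (n + 1) (j + 1))
        + b z (vtx (n + 2) j) + b z (vtx (n + 2) (j + 1)) + b z (lnk (n + 2) j))) := by
  simp only [expE, exponent, oddSites, evenSites, czPairs, site, List.map_cons, List.map_nil,
    List.sum_cons, List.sum_nil, List.flatMap_cons, List.flatMap_nil, List.cons_append,
    List.nil_append, List.append_nil, Int.cast_neg, Int.cast_one, Int.cast_zero, add_zero,
    ← sub_eq_add_neg, zero_add, neg_add_cancel, Int.cast_ofNat]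
  ring

lemma SE_eq_mono [NeZero N1] [NeZero N2] (n : ZMod N2) (j : ZMod N1) :
    SE n j = mono (flipE n j) (expE n j) :=
  congrArg (fun f => mono (flipE n j) f) (funext fun z => (expE_eq n j z).symm)

lemma list_sum_polar {α : Type*} (l : List α) (h k : α → ZMod 4) :
    (l.map fun x => h x + k x + 2 * h x * k x).sum
      = (l.map h).sum + (l.map k).sum + 2 * (l.map fun x => h x * k x).sum := by
  induction l with
  | nil => simp
  | cons x l ih => simp only [List.map_cons, List.sum_cons, ih]; ring

/-- Under the outer factor 2 the corrections `2 * h * k` acquire a factor 4, so the doubled product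
is bilinear. -/
lemma list_sum_polar_mul {α : Type*} (l : List (α × α)) (h k : α → ZMod 4) :
    2 * (l.map fun x => (h x.1 + k x.1 + 2 * h x.1 * k x.1)
        * (h x.2 + k x.2 + 2 * h x.2 * k x.2)).sum
      = 2 * (l.map fun x => h x.1 * h x.2).sum + 2 * (l.map fun x => k x.1 * k x.2).sum
        + 2 * (l.map fun x => h x.1 * k x.2).sum + 2 * (l.map fun x => h x.2 * k x.1).sum := by
  induction l with
  | nil => simp
  | cons x l ih =>
    simp only [List.map_cons, List.sum_cons]
    grind

/-- The polar form of `exponent`. -/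
lemma exponent_add (h k : RelSite → ZMod 4) :
    exponent (fun x => h x + k x + 2 * h x * k x)
      = exponent h + exponent k + 2 + 2 * (polarPairs.map fun x => h x.1 * k x.2).sum := by
  have hp : (polarPairs.map fun x => h x.1 * k x.2).sum
      = (oddSites.map fun x => h x * k x).sum + (czPairs.map fun x => h x.1 * k x.2).sum
        + (czPairs.map fun x => h x.2 * k x.1).sum := by
    simp only [polarPairs, List.map_append, List.sum_append, List.map_map]
    rfl
  -- The constant 2 of `exponent` occurs once on the left and twice on the right; the extra 2
  -- balances it, since $2+2+2=2$ modulo 4.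
  rw [exponent, list_sum_polar, list_sum_polar, list_sum_polar_mul, hp, exponent, exponent]
  grind

lemma b_sum_e {L : List (Site N1 N2)} (hL : L.Nodup) (a : Site N1 N2) :
    b (L.map e).sum a = (L.map fun c => if a = c then 1 else 0).sum := by
  induction L with
  | nil => rfl
  | cons c L ih =>
    rw [List.nodup_cons] at hL
    rw [List.map_cons, List.sum_cons, b_add, b_e, ih hL.2, List.map_cons, List.sum_cons]
    by_cases h : a = c
    · have h0 : (L.map fun d => if a = d then (1 : ZMod 4) else 0).sum = 0 := by
        refine List.sum_eq_zero fun x hx => ?_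
        obtain ⟨d, hd, rfl⟩ := List.mem_map.1 hx
        rw [if_neg]
        rintro rfl
        exact hL.1 (h ▸ hd)
      rw [h0]
      ring
    · rw [if_neg h]
      ring

lemma add_one_ne {N : ℕ} (hN : 2 ≤ N) (n : ZMod N) : n + 1 ≠ n := by
  have : Fact (1 < N) := ⟨hN⟩
  simp

lemma sub_one_ne {N : ℕ} (hN : 2 ≤ N) (n : ZMod N) : n - 1 ≠ n := by
  have : Fact (1 < N) := ⟨hN⟩
  simp

lemma flipE_eq (n : ZMod N2) (j : ZMod N1) :
    flipE n j = ((flipSites.map (site n j)).map e).sum := by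
  simp [flipE, flipSites, site, sub_eq_add_neg, add_assoc]

lemma flipSites_nodup (hN1 : 2 ≤ N1) (hN2 : 2 ≤ N2) (n : ZMod N2) (j : ZMod N1) :
    (flipSites.map (site n j)).Nodup := by
  have h1 := add_one_ne hN2 n
  have h2 := sub_one_ne hN1 j
  simp [flipSites, site, h1.symm, h2, ← sub_eq_add_neg]

/-- The displacement of two sites of the same kind. -/
def disp (x y : RelSite) : ℤ × ℤ := (x.2.1 - y.2.1, x.2.2 - y.2.2)

/-- Whether `(n', j')` is the base point displaced by `δ` from `(n, j)`. -/
def isDisp (n n' : ZMod N2) (j j' : ZMod N1) (δ : ℤ × ℤ) : ZMod 4 :=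
  if n' = n + δ.1 ∧ j' = j + δ.2 then 1 else 0

lemma site_eq_site (n n' : ZMod N2) (j j' : ZMod N1) (x y : RelSite) :
    site n j x = site n' j' y ↔
      x.1 = y.1 ∧ n' = n + (disp x y).1 ∧ j' = j + (disp x y).2 := by
  have h (m m' : ZMod N2) (i i' : ZMod N1) (a c a' c' : ℤ) :
      (m + a = m' + a' ∧ i + c = i' + c') ↔
        m' = m + ((a - a' : ℤ) : ZMod N2) ∧ i' = i + ((c - c' : ℤ) : ZMod N1) := by
    push_cast
    constructor
    · rintro ⟨h, h'⟩
      exact ⟨by linear_combination -h, by linear_combination -h'⟩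
    · rintro ⟨h, h'⟩
      exact ⟨by linear_combination -h, by linear_combination -h'⟩
  obtain ⟨_ | _, a, c⟩ := x <;> obtain ⟨_ | _, a', c'⟩ := y <;> simp [site, disp]
  · simpa using h n n' j j' a c a' c'
  · simpa using h n n' j j' a c a' c'

/-- For $N_1,N_2\ge2$ the four flipped sites stay distinct on the torus, so the bit is a plain sum
of indicators without carries. Coincidences caused by wrapping around are absorbed in `isDisp` and
need no case distinction. -/
lemma b_flipE (hN1 : 2 ≤ N1) (hN2 : 2 ≤ N2) (n n' : ZMod N2) (j j' : ZMod N1) (x : RelSite) :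
    b (flipE n' j') (site n j x)
      = (flipSites.map fun y => if x.1 = y.1 then isDisp n n' j j' (disp x y) else 0).sum := by
  rw [flipE_eq, b_sum_e (flipSites_nodup hN1 hN2 n' j'), List.map_map]
  refine congrArg List.sum (List.map_congr_left fun y _ => ?_)
  simp only [Function.comp_apply, isDisp, site_eq_site, ite_and]

/-- The polar form of `exponent` with the flips of an `S^E`: pairs of a site and a displacement
of the second `S^E`. -/
def crossTerms : List (RelSite × (ℤ × ℤ)) :=
  polarPairs.flatMap fun x =>
    (flipSites.filter fun y => x.2.1 = y.1).map fun y => (x.1, disp x.2 y)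

/-- The same terms as seen from the base point of the other operator. -/
def revTerm (x : RelSite × (ℤ × ℤ)) : RelSite × (ℤ × ℤ) :=
  ((x.1.1, x.1.2 - x.2), -x.2)

lemma list_sum_ite {α : Type*} (l : List α) (p : α → Prop) [DecidablePred p]
    (f : α → ZMod 4) :
    (l.map fun y => if p y then f y else 0).sum = ((l.filter fun y => p y).map f).sum := by
  induction l with
  | nil => rfl
  | cons x l ih => by_cases h : p x <;> simp [h, ih]

lemma polar_flipE (hN1 : 2 ≤ N1) (hN2 : 2 ≤ N2) (n n' : ZMod N2) (j j' : ZMod N1)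
    (h : RelSite → ZMod 4) :
    (polarPairs.map fun x => h x.1 * b (flipE n' j') (site n j x.2)).sum
      = (crossTerms.map fun x => h x.1 * isDisp n n' j j' x.2).sum := by
  rw [crossTerms, List.map_flatMap, List.flatMap_def, List.sum_flatten, List.map_map]
  refine congrArg List.sum (List.map_congr_left fun x _ => ?_)
  rw [Function.comp_apply, b_flipE hN1 hN2, list_sum_ite, List.map_map, ← List.sum_map_mul_left]
  rfl

/-- Terms of even multiplicity vanish after doubling in `ZMod 4`. This reduces equality of polar
forms to counting entries of explicit lists. -/
lemma two_mul_list_sum_eq {α : Type*} [DecidableEq α] (l l' : List α)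
    (h : ∀ a ∈ l ++ l', Even ((l ++ l').count a)) (f : α → ZMod 4) :
    2 * (l.map f).sum = 2 * (l'.map f).sum := by
  have h0 : 2 * ((l ++ l').map f).sum = 0 := by
    rw [Finset.sum_list_map_count, Finset.mul_sum]
    refine Finset.sum_eq_zero fun a ha => ?_
    obtain ⟨k, hk⟩ := h a (by simpa using ha)
    rw [hk, nsmul_eq_mul]
    push_cast
    linear_combination (k * f a) * four_eq_zero
  rw [List.map_append, List.sum_append] at h0
  linear_combination h0 - (l'.map f).sum * four_eq_zero

/-- A parity count on the infinite lattice, independent of the size of the torus: the linear part of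
the commutator phase of two $S^E$ is the same seen from either base point. -/
lemma crossTerms_symm :
    ∀ a ∈ crossTerms ++ crossTerms.map revTerm,
      Even ((crossTerms ++ crossTerms.map revTerm).count a) := by
  decide +kernel

lemma isDisp_neg (n n' : ZMod N2) (j j' : ZMod N1) (δ : ℤ × ℤ) :
    isDisp n n' j j' (-δ) = isDisp n' n j' j δ := by
  refine if_congr ?_ rfl rfl
  simp only [Prod.fst_neg, Prod.snd_neg, Int.cast_neg, ← sub_eq_add_neg, eq_sub_iff_add_eq]
  exact and_congr eq_comm eq_comm

lemma mul_isDisp_rev (n n' : ZMod N2) (j j' : ZMod N1) (z : Config N1 N2)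
    (x : RelSite × (ℤ × ℤ)) :
    b z (site n j (revTerm x).1) * isDisp n n' j j' (revTerm x).2
      = b z (site n' j' x.1) * isDisp n' n j' j x.2 := by
  obtain ⟨⟨k, a, c⟩, d, d'⟩ := x
  rw [revTerm, isDisp_neg, isDisp]
  split_ifs with h
  · obtain ⟨rfl, rfl⟩ := h
    congr 2
    cases k <;> simp [site, add_assoc]
  · rw [mul_zero, mul_zero]

lemma polar_flipE_symm (hN1 : 2 ≤ N1) (hN2 : 2 ≤ N2) (n n' : ZMod N2) (j j' : ZMod N1)
    (z : Config N1 N2) :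
    2 * (polarPairs.map fun x => b z (site n j x.1) * b (flipE n' j') (site n j x.2)).sum
      = 2 * (polarPairs.map fun x =>
          b z (site n' j' x.1) * b (flipE n j) (site n' j' x.2)).sum := by
  rw [polar_flipE hN1 hN2 n n' j j' fun x => b z (site n j x),
    polar_flipE hN1 hN2 n' n j' j fun x => b z (site n' j' x),
    two_mul_list_sum_eq crossTerms (crossTerms.map revTerm)
      (by convert crossTerms_symm), List.map_map]
  refine congrArg (fun l => 2 * List.sum l) (List.map_congr_left fun x _ => ?_)
  exact mul_isDisp_rev n n' j j' z x

/-- The value of the flips of an `S^E`, where `A` and `C` tell the displacements of layers and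
columns. -/
def flipValue (A C : ℤ → ZMod 4) (x : RelSite) : ZMod 4 :=
  (flipSites.map fun y => if x.1 = y.1 then A (disp x y).1 * C (disp x y).2 else 0).sum

/-- Reversing the displacements exchanges the roles of two $S^E$, so this is the constant part of
their commutator phase. The hypotheses on `A` and `C` record that consecutive displacements are
distinct modulo a size of at least 2. -/
lemma exponent_flipValue_neg (A C : ℤ → Fin 2) (hA : ∀ a, A a = 0 ∨ A (a + 1) = 0)
    (hC : ∀ c, C c = 0 ∨ C (c + 1) = 0) :
    exponent (flipValue (fun a => (A a : ℕ)) fun c => (C c : ℕ))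
      = exponent (flipValue (fun a => (A (-a) : ℕ)) fun c => (C (-c) : ℕ)) := by
  have h1 := hA (-2)
  have h2 := hA (-1)
  have h3 := hA 0
  have h4 := hA 1
  have h5 := hC (-1)
  have h6 := hC 0
  norm_num at h1 h2 h3 h4 h5 h6
  norm_num [exponent, flipValue, oddSites, evenSites, czPairs, flipSites, disp]
  generalize A (-2) = x1, A (-1) = x2, A 0 = x3, A 1 = x4, A 2 = x5, C (-1) = y1, C 0 = y2,
    C 1 = y3 at *
  clear hA hC A C
  revert h1 h2 h3 h4 h5 h6
  revert x1 x2 x3 x4 x5 y1 y2 y3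
  decide +kernel


lemma expE_add (n : ZMod N2) (j : ZMod N1) (z s : Config N1 N2) :
    expE n j (z + s) = expE n j z + expE n j s + 2
      + 2 * (polarPairs.map fun x => b z (site n j x.1) * b s (site n j x.2)).sum := by
  unfold expE
  simp_rw [b_add]
  exact exponent_add _ _

lemma fin_two_dichotomy {p q : Prop} [Decidable p] [Decidable q] (h : p → ¬q) :
    (if p then (1 : Fin 2) else 0) = 0 ∨ (if q then (1 : Fin 2) else 0) = 0 := by
  by_cases hp : p
  · exact Or.inr (if_neg (h hp))
  · exact Or.inl (if_neg hp)

lemma disp_dichotomy {N : ℕ} (hN : 2 ≤ N) (n n' : ZMod N) (a : ℤ) :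
    (if n' = n + (a : ZMod N) then (1 : Fin 2) else 0) = 0 ∨
      (if n' = n + ((a + 1 : ℤ) : ZMod N) then (1 : Fin 2) else 0) = 0 := by
  refine fin_two_dichotomy fun h h' => add_one_ne hN n' ?_
  push_cast at h'
  linear_combination h - h'

lemma ite_cast_fin_two (p : Prop) [Decidable p] :
    (((if p then (1 : Fin 2) else 0 : Fin 2) : ℕ) : ZMod 4) = if p then 1 else 0 := by
  split_ifs <;> rfl

lemma expE_flipE (hN1 : 2 ≤ N1) (hN2 : 2 ≤ N2) (n n' : ZMod N2) (j j' : ZMod N1) :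
    expE n j (flipE n' j') = exponent (flipValue
      (fun a => (if n' = n + (a : ZMod N2) then (1 : Fin 2) else 0 : Fin 2))
      (fun c => (if j' = j + (c : ZMod N1) then (1 : Fin 2) else 0 : Fin 2))) := by
  unfold expE
  congr 1
  ext1 x
  rw [b_flipE hN1 hN2]
  simp only [flipValue, isDisp, ite_cast_fin_two, ← ite_and, ite_zero_mul_ite_zero, mul_one]

lemma expE_flipE_symm (hN1 : 2 ≤ N1) (hN2 : 2 ≤ N2) (n n' : ZMod N2) (j j' : ZMod N1) :
    expE n j (flipE n' j') = expE n' j' (flipE n j) := by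
  have h {N : ℕ} (m m' : ZMod N) (a : ℤ) :
      m' = m + ((-a : ℤ) : ZMod N) ↔ m = m' + (a : ZMod N) := by
    rw [Int.cast_neg, ← sub_eq_add_neg, eq_sub_iff_add_eq, eq_comm]
  rw [expE_flipE hN1 hN2, expE_flipE hN1 hN2,
    exponent_flipValue_neg _ _ (disp_dichotomy hN2 n n') (disp_dichotomy hN1 j j')]
  simp only [h]

/-- `A 2` is left free because a displacement by two layers is trivial exactly when $N_2=2$. -/
lemma exponent_flipValue_self (A C : ℤ → Fin 2) (hA0 : A 0 = 1) (hA1 : A 1 = 0)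
    (hA2 : A (-1) = 0) (hC0 : C 0 = 1) (hC1 : C 1 = 0) (hC2 : C (-1) = 0) :
    exponent (flipValue (fun a => (A a : ℕ)) fun c => (C c : ℕ)) = 2 := by
  norm_num [exponent, flipValue, oddSites, evenSites, czPairs, flipSites, disp, hA0, hA1, hA2,
    hC0, hC1, hC2]
  generalize A 2 = x
  revert x
  decide +kernel

lemma crossTerms_disp : ∀ x ∈ crossTerms, x.2 = (0, 0) ∨ x.2 = (2, 0) ∨
    x.2.1 = 1 ∨ x.2.1 = -1 ∨ x.2.2 = 1 ∨ x.2.2 = -1 := by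
  decide +kernel

lemma crossTerms_self :
    ∀ a ∈ (crossTerms.filter fun x : RelSite × (ℤ × ℤ) => x.2 = (0, 0)).map Prod.fst ++ oddSites,
      Even (((crossTerms.filter fun x : RelSite × (ℤ × ℤ) => x.2 = (0, 0)).map Prod.fst
        ++ oddSites).count a) := by
  decide +kernel

lemma crossTerms_two :
    ∀ a ∈ (crossTerms.filter fun x : RelSite × (ℤ × ℤ) => x.2 = (2, 0)).map Prod.fst ++ [],
      Even (((crossTerms.filter fun x : RelSite × (ℤ × ℤ) => x.2 = (2, 0)).map Prod.fst
        ++ []).count a) := by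
  decide +kernel

/-- An operator meets its own flips only at displacements that are trivial on the torus: $(0,0)$,
whose terms add up to the `S†` sites modulo 2, and for $N_2=2$ also $(2,0)$, whose terms cancel in
pairs. -/
lemma polar_flipE_self (hN1 : 2 ≤ N1) (hN2 : 2 ≤ N2) (n : ZMod N2) (j : ZMod N1)
    (h : RelSite → ZMod 4) :
    2 * (polarPairs.map fun x => h x.1 * b (flipE n j) (site n j x.2)).sum
      = 2 * (oddSites.map h).sum := by
  have e1 := two_mul_list_sum_eq ((crossTerms.filter fun x => x.2 = (0, 0)).map Prod.fst) oddSites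
    (by convert crossTerms_self) h
  have e2 := two_mul_list_sum_eq ((crossTerms.filter fun x => x.2 = (2, 0)).map Prod.fst) []
    (by convert crossTerms_two) h
  rw [List.map_map] at e1 e2
  -- All other displacements have a component $\pm1$, which is nonzero modulo a size of at least 2.
  have key : (crossTerms.map fun x => h x.1 * isDisp n n j j x.2).sum
      = (crossTerms.map fun x => (if x.2 = (0, 0) then h x.1 else 0)
        + isDisp n n j j (2, 0) * if x.2 = (2, 0) then h x.1 else 0).sum := by
    refine congrArg List.sum (List.map_congr_left fun x hx => ?_)
    have h1 {N : ℕ} (hN : 2 ≤ N) (m : ZMod N) : ¬ m = m + 1 := (add_one_ne hN m).symm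
    have h2 {N : ℕ} (hN : 2 ≤ N) (m : ZMod N) : ¬ m = m + -1 := by
      rw [← sub_eq_add_neg]
      exact (sub_one_ne hN m).symm
    obtain ⟨s, d, d'⟩ := x
    rcases crossTerms_disp _ hx with h' | h' | h' | h' | h' | h'
    · simp only [Prod.mk.injEq] at h'
      simp [h', isDisp]
    · simp only [Prod.mk.injEq] at h'
      simp [h', mul_comm]
    all_goals
      simp only at h'
      subst h'
      simp only [isDisp, Int.cast_one, Int.cast_neg, h1 hN1, h1 hN2, h2 hN1, h2 hN2]
      simp
  rw [polar_flipE hN1 hN2 n n j j h, key, List.sum_map_add, List.sum_map_mul_left, list_sum_ite,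
    list_sum_ite, mul_add, mul_left_comm]
  simp only [Function.comp_def, List.map_nil, List.sum_nil, mul_zero] at e1 e2
  rw [e1, e2]
  simp

/-! ### Commutation and squares of the $S^E$ -/

section

variable [NeZero N1] [NeZero N2]

lemma SE_commute (hN1 : 2 ≤ N1) (hN2 : 2 ≤ N2) (n n' : ZMod N2) (j j' : ZMod N1) :
    Commute (SE n j : Op N1 N2) (SE n' j') := by
  rw [SE_eq_mono, SE_eq_mono]
  refine mono_commute fun z => ?_
  rw [expE_add, expE_add, expE_flipE_symm hN1 hN2 n n' j j', polar_flipE_symm hN1 hN2 n n' j j']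
  ring

lemma SE_mul_self (hN1 : 2 ≤ N1) (hN2 : 2 ≤ N2) (n : ZMod N2) (j : ZMod N1) :
    SE n j * SE n j = (1 : Op N1 N2) := by
  have h1 {N : ℕ} (hN : 2 ≤ N) (m : ZMod N) : ¬ m = m + 1 := (add_one_ne hN m).symm
  have h2 {N : ℕ} (hN : 2 ≤ N) (m : ZMod N) : ¬ m = m + -1 := by
    rw [← sub_eq_add_neg]
    exact (sub_one_ne hN m).symm
  rw [SE_eq_mono, mono_mul, ← mono_zero_zero]
  refine mono_congr (config_add_self _) fun z => ?_
  -- With $o$ the sum of the bits on the `S†` sites, doubling the exponent leaves $4+6o$. The flip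
  -- value 2, the constant 2 and the polar form $2o$ bring the total to $8+8o=0$.
  rw [expE_add, expE_flipE hN1 hN2, exponent_flipValue_self,
    polar_flipE_self hN1 hN2 n j fun x => b z (site n j x), expE, exponent]
  · simp only [Pi.zero_apply]
    grind
  all_goals simp [h1 hN1, h1 hN2, h2 hN1, h2 hN2]

end

/-! ### Boundaries and closed configurations -/

section

variable {N1 N2 : ℕ}

/-- The configuration `∑ a p • flipE p`. -/
def boundary (a : ZMod N2 × ZMod N1 → ZMod 2) : Config N1 N2
  | Sum.inl (n, j) => a (n, j) + a (n - 1, j)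
  | Sum.inr (n, j) => a (n, j) + a (n, j + 1)

lemma boundary_add (a c : ZMod N2 × ZMod N1 → ZMod 2) :
    boundary (a + c) = boundary a + boundary c := by
  ext (⟨n, j⟩ | ⟨n, j⟩) <;> simp only [boundary, Pi.add_apply] <;> ring

lemma flipE_eq_boundary (n : ZMod N2) (j : ZMod N1) :
    flipE n j = boundary (Pi.single (n, j) 1) := by
  ext (⟨m, i⟩ | ⟨m, i⟩)
  · simp [flipE, boundary, Pi.single_apply, sub_eq_iff_eq_add]
  · simp [flipE, boundary, Pi.single_apply, eq_sub_iff_add_eq, add_comm]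

/-- The parity of a configuration at the sites of `S^M`. -/
def face (n : ZMod N2) (j : ZMod N1) (z : Config N1 N2) : ZMod 2 :=
  z (vtx n j) + z (vtx n (j + 1)) + z (lnk (n - 1) j) + z (lnk n j)

lemma face_add (n : ZMod N2) (j : ZMod N1) (z s : Config N1 N2) :
    face n j (z + s) = face n j z + face n j s := by
  simp only [face, Pi.add_apply]
  ring

/-- This is $\partial\partial=0$: each of the four coefficients involved occurs twice. It makes
every $S^M$ meet the flips of every $S^E$ evenly, hence commute with it. -/
lemma face_boundary (n : ZMod N2) (j : ZMod N1) (a : ZMod N2 × ZMod N1 → ZMod 2) :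
    face n j (boundary a) = 0 := by
  simp only [face, boundary]
  grind

lemma face_flipE (n n' : ZMod N2) (j j' : ZMod N1) : face n j (flipE n' j') = 0 := by
  rw [flipE_eq_boundary, face_boundary]

variable [NeZero N1] [NeZero N2]

lemma SM_eq_mono (n : ZMod N2) (j : ZMod N1) :
    SM n j = mono 0 fun z => 2 * ((face n j z).val : ZMod 4) := by
  simp only [SM, pauliZ, phase_eq_mono, mono_mul, add_zero]
  refine mono_congr rfl fun z => ?_
  simp only [face, b]
  generalize z (vtx n j) = p, z (vtx n (j + 1)) = q, z (lnk (n - 1) j) = r, z (lnk n j) = s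
  revert p q r s
  decide

lemma SM_mul_self (n : ZMod N2) (j : ZMod N1) : SM n j * SM n j = (1 : Op N1 N2) := by
  rw [SM_eq_mono, mono_mul, ← mono_zero_zero]
  refine mono_congr (add_zero _) fun z => ?_
  simp only [add_zero, Pi.zero_apply]
  grind

lemma SM_commute (n n' : ZMod N2) (j j' : ZMod N1) :
    Commute (SM n j : Op N1 N2) (SM n' j') := by
  rw [SM_eq_mono, SM_eq_mono]
  refine mono_commute fun z => ?_
  simp only [add_zero]
  ring

lemma SE_commute_SM (n n' : ZMod N2) (j j' : ZMod N1) :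
    Commute (SE n j : Op N1 N2) (SM n' j') := by
  rw [SE_eq_mono, SM_eq_mono]
  refine mono_commute fun z => ?_
  simp only [add_zero, face_add, face_flipE]
  ring

end

/-! ### Products of commuting operators -/

section

variable {N1 N2 : ℕ} [NeZero N1] [NeZero N2]

open scoped IsMulCommutative in
/-- A commuting family of operators lives in a commutative algebra. -/
lemma exists_commRing {ι : Type*} (S : ι → Op N1 N2) (hS : ∀ i k, Commute (S i) (S k)) :
    ∃ (R : Type) (_ : CommRing R) (_ : Algebra ℂ R) (φ : R →ₐ[ℂ] Op N1 N2) (s : ι → R),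
      Function.Injective φ ∧ ∀ i, φ (s i) = S i := by
  have hc : ∀ a ∈ Set.range S, ∀ c ∈ Set.range S, a * c = c * a := by
    rintro _ ⟨i, rfl⟩ _ ⟨k, rfl⟩
    exact hS i k
  have := Algebra.isMulCommutative_adjoin ℂ hc
  exact ⟨Algebra.adjoin ℂ (Set.range S), inferInstance, inferInstance,
    (Algebra.adjoin ℂ (Set.range S)).val, fun i => ⟨S i, Algebra.subset_adjoin ⟨i, rfl⟩⟩,
    Subtype.val_injective, fun i => rfl⟩

/-- Inside a commutative ring the ordered list product becomes a `Finset` product, which can be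
regrouped and expanded freely. -/
lemma prodAll_eq_map {R : Type} [CommRing R] [Algebra ℂ R] (φ : R →ₐ[ℂ] Op N1 N2)
    {s : ZMod N2 × ZMod N1 → R} {F : ZMod N2 → ZMod N1 → Op N1 N2}
    (h : ∀ p, φ (s p) = F p.1 p.2) : prodAll F = φ (∏ p, s p) := by
  rw [prodAll, ← Finset.prod_map_toList, map_list_prod, List.map_map]
  exact congrArg List.prod (List.map_congr_left fun p _ => (h p).symm)

lemma zmod_prod_eq_range {N : ℕ} [NeZero N] {R : Type*} [CommMonoid R] (g : ZMod N → R) :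
    ∏ j, g j = ∏ i ∈ Finset.range N, g (i : ZMod N) := by
  symm
  refine Finset.prod_bij' (fun i _ => (i : ZMod N)) (fun j _ => j.val) ?_ ?_ ?_ ?_ ?_
  · simp
  · intro j _
    simpa using j.val_lt
  · intro i hi
    exact ZMod.val_cast_of_lt (by simpa using hi)
  · simp
  · simp

lemma zmod_sum_eq_range {N : ℕ} [NeZero N] {R : Type*} [AddCommMonoid R] (g : ZMod N → R) :
    ∑ j, g j = ∑ i ∈ Finset.range N, g (i : ZMod N) :=
  zmod_prod_eq_range (R := Multiplicative R) g

/-! ### The product over a row -/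

/-- The flips of the product of `S^E` over the first `m + 1` columns of a row. -/
def stringE (n : ZMod N2) (m : ℕ) : Config N1 N2
  | Sum.inl (r, j) => if (r = n ∨ r = n + 1) ∧ j.val ≤ m then 1 else 0
  | Sum.inr (r, j) => if r = n then (if j = -1 then 1 else 0) + (if j = (m : ZMod N1) then 1 else 0)
      else 0

/-- The flips of a Levin-Gu symmetry. -/
def rowFlip (n : ZMod N2) : Config N1 N2
  | Sum.inl (r, _) => if r = n then 1 else 0
  | Sum.inr _ => 0

lemma sum_vtx_eq_rowFlip (n : ZMod N2) :
    ∑ j : ZMod N1, e (vtx n j) = (rowFlip n : Config N1 N2) := by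
  ext (⟨r, j⟩ | ⟨r, j⟩)
  · rw [Finset.sum_apply]
    by_cases h : r = n <;> simp [rowFlip, Pi.single_apply, h]
  · simp [Finset.sum_apply, rowFlip]

lemma stringE_zero (hN2 : 2 ≤ N2) (n : ZMod N2) :
    (stringE n 0 : Config N1 N2) = flipE n 0 := by
  have h := add_one_ne hN2 n
  ext (⟨r, j⟩ | ⟨r, j⟩)
  · by_cases h1 : r = n
    · subst h1
      simp [stringE, flipE, Pi.single_apply, h.symm]
    · simp [stringE, flipE, Pi.single_apply, h1, ite_and]
  · by_cases h1 : r = n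
    · subst h1
      simp [stringE, flipE, Pi.single_apply]
    · simp [stringE, flipE, h1]

lemma val_eq_succ_iff {N m : ℕ} [NeZero N] (hm : m + 1 < N) (j : ZMod N) :
    j.val = m + 1 ↔ j = (m : ZMod N) + 1 := by
  rw [← ZMod.val_injective N |>.eq_iff]
  have h : ((m : ZMod N) + 1).val = m + 1 := by
    exact_mod_cast ZMod.val_cast_of_lt hm
  rw [h]

lemma flipE_add_stringE_apply (hN2 : 2 ≤ N2) (n : ZMod N2) {m : ℕ} (hm : m + 1 < N1)
    (r : ZMod N2) (j : ZMod N1) :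
    (flipE n ((m : ZMod N1) + 1) + stringE n m : Config N1 N2) (vtx r j)
      = if (r = n ∨ r = n + 1) ∧ j.val ≤ m + 1 then 1 else 0 := by
  have h := add_one_ne hN2 n
  have hj := val_eq_succ_iff hm j
  have hle : j.val ≤ m + 1 ↔ j.val ≤ m ∨ j = (m : ZMod N1) + 1 := by
    rw [← hj]; omega
  have hnot : j = (m : ZMod N1) + 1 → ¬ j.val ≤ m := by
    rw [← hj]; omega
  simp only [flipE, stringE, Pi.add_apply, Pi.single_apply, hle, Sum.inl.injEq, Prod.mk.injEq,
    reduceCtorEq, if_false, add_zero]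
  have hne (h1 : r = n) : ¬ r = n + 1 := fun h2 => h (h2.symm.trans h1)
  by_cases h1 : r = n <;> by_cases h2 : r = n + 1 <;> by_cases h3 : j = (m : ZMod N1) + 1 <;>
    by_cases h4 : j.val ≤ m <;> simp_all

lemma flipE_add_stringE (hN2 : 2 ≤ N2) (n : ZMod N2) {m : ℕ} (hm : m + 1 < N1) :
    (flipE n ((m : ZMod N1) + 1) + stringE n m : Config N1 N2) = stringE n (m + 1) := by
  ext (⟨r, j⟩ | ⟨r, j⟩)
  · exact flipE_add_stringE_apply hN2 n hm r j
  · by_cases h1 : r = n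
    · subst h1
      simp only [stringE, flipE, Pi.single_apply, Pi.add_apply, reduceCtorEq, if_false,
        Sum.inr.injEq, Prod.mk.injEq, true_and, if_true, Nat.cast_add, Nat.cast_one,
        add_sub_cancel_right]
      grind
    · simp [stringE, flipE, h1]

/-- With the last column the string closes: its two gauge-qubit ends meet and cancel, and two full
matter rows remain. -/
lemma flipE_add_stringE_last (hN2 : 2 ≤ N2) (n : ZMod N2) {m : ℕ} (hm : m + 2 = N1) :
    (flipE n ((m : ZMod N1) + 1) + stringE n m : Config N1 N2) = rowFlip n + rowFlip (n + 1) := by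
  ext (⟨r, j⟩ | ⟨r, j⟩)
  · refine (flipE_add_stringE_apply hN2 n (by omega) r j).trans ?_
    have := j.val_lt
    have h := add_one_ne hN2 n
    have hj : j.val ≤ m + 1 := by omega
    by_cases h1 : r = n
    · subst h1
      simp [rowFlip, hj, h.symm]
    · simp [rowFlip, hj, h1]
  · have h2 : ((m : ZMod N1) + 1) = -1 := by
      rw [eq_neg_iff_add_eq_zero, add_assoc, one_add_one_eq_two]
      exact_mod_cast (by rw [hm]; simp : ((m + 2 : ℕ) : ZMod N1) = 0)
    by_cases h1 : r = n
    · subst h1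
      simp only [stringE, flipE, Pi.single_apply, Pi.add_apply, reduceCtorEq, if_false,
        Sum.inr.injEq, Prod.mk.injEq, true_and, if_true, rowFlip, h2]
      grind
    · simp [stringE, flipE, rowFlip, h1]

end

variable {N1 N2 : ℕ} [NeZero N1] [NeZero N2]

/-! ### Levin-Gu symmetries -/

/-- The exponent of the phases of a Levin-Gu symmetry. -/
def rowExp (n : ZMod N2) (z : Config N1 N2) : ZMod 4 :=
  ∑ j : ZMod N1, lExp z (vtx n j) (vtx n (j + 1))

lemma sum_shift (h : ZMod N1 → ZMod 4) :
    ∑ j : ZMod N1, h (j + 1) = ∑ j, h j :=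
  Fintype.sum_equiv (Equiv.addRight 1) _ _ fun _ => rfl

lemma rowX_eq_mono (n : ZMod N2) : rowX n = mono (rowFlip n : Config N1 N2) 0 := by
  rw [rowX, flipX_eq_mono, sum_vtx_eq_rowFlip]

lemma levinGu_eq_mono (n : ZMod N2) :
    levinGu n = mono (rowFlip n : Config N1 N2) fun z => 2 + rowExp n z := by
  rw [levinGu, rowX_eq_mono, phase_eq_mono, mono_mul, neg_mono]
  exact mono_congr (add_zero _) fun z => by simp [rowExp]

/-- Each bond of row `n` has both ends flipped or neither, so no `L` changes. -/
lemma rowExp_add_rowFlip (n m : ZMod N2) (z : Config N1 N2) :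
    rowExp n (z + rowFlip m) = rowExp n z := by
  refine Finset.sum_congr rfl fun j _ => ?_
  unfold lExp
  congr 2
  simp only [Pi.add_apply, rowFlip]
  grind

lemma rowExp_eq (n : ZMod N2) (z : Config N1 N2) :
    rowExp n z = ∑ j : ZMod N1, (2 * b z (vtx n j) + 2 * b z (vtx n j) * b z (vtx n (j + 1))) := by
  simp only [rowExp, lExp_eq, Finset.sum_add_distrib]
  rw [sum_shift fun j => b z (vtx n j), ← two_mul, Finset.mul_sum]

lemma two_mul_rowExp (n : ZMod N2) (z : Config N1 N2) : 2 * rowExp n z = 0 := by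
  rw [rowExp_eq, Finset.mul_sum]
  refine Finset.sum_eq_zero fun j _ => ?_
  grind

lemma levinGu_mul (n m : ZMod N2) :
    levinGu n * levinGu m = mono (rowFlip n + rowFlip m : Config N1 N2)
      fun z => rowExp n z + rowExp m z := by
  rw [levinGu_eq_mono, levinGu_eq_mono, mono_mul]
  refine mono_congr rfl fun z => ?_
  rw [rowExp_add_rowFlip]
  grind

lemma levinGu_commute (n m : ZMod N2) : Commute (levinGu n : Op N1 N2) (levinGu m) := by
  rw [Commute, SemiconjBy, levinGu_mul, levinGu_mul]
  exact mono_congr (add_comm _ _) fun z => add_comm _ _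

lemma levinGu_mul_self (n : ZMod N2) : levinGu n * levinGu n = (1 : Op N1 N2) := by
  rw [levinGu_mul, ← mono_zero_zero]
  refine mono_congr (config_add_self _) fun z => ?_
  rw [← two_mul, two_mul_rowExp, Pi.zero_apply]

/-! ### The product of all `S^E` -/

/-- The contribution of a column to the exponent of the product of the Levin-Gu symmetries of two
adjacent rows. -/
def colExp (n : ZMod N2) (j : ZMod N1) (z : Config N1 N2) : ZMod 4 :=
  2 * b z (vtx n j) + 2 * b z (vtx n j) * b z (vtx n (j + 1))
    + 2 * b z (vtx (n + 1) j) + 2 * b z (vtx (n + 1) j) * b z (vtx (n + 1) (j + 1))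

/-- The exponent at the end of a partial product of `S^E` over a row. -/
def endExp (n : ZMod N2) (j : ZMod N1) (z : Config N1 N2) : ZMod 4 :=
  3 * b z (lnk n j) + b z (vtx n j) + 2 * b z (vtx n (j + 1)) + 3 * b z (vtx (n + 1) (j + 1))
    + 2 * b z (lnk (n + 1) j) * (b z (lnk (n + 2) j) + b z (vtx n j) + b z (vtx n (j + 1))
      + b z (vtx (n + 1) j) + b z (vtx (n + 1) (j + 1)) + b z (vtx (n + 2) j)
      + b z (vtx (n + 2) (j + 1)))
    + 2 * (b z (vtx n j) * b z (vtx (n + 1) (j + 1)) + b z (vtx n (j + 1)) * b z (vtx (n + 1) j)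
      + b z (vtx n (j + 1)) * b z (vtx (n + 1) (j + 1))
      + b z (vtx (n + 1) j) * b z (vtx (n + 1) (j + 1)) + b z (vtx n j) * b z (vtx (n + 1) j))

lemma b_stringE_vtx (n r : ZMod N2) (m : ℕ) (j : ZMod N1) :
    b (stringE n m) (vtx r j) = if (r = n ∨ r = n + 1) ∧ j.val ≤ m then 1 else 0 := by
  simp only [b, stringE]
  split_ifs <;> rfl

lemma b_stringE_lnk (n r : ZMod N2) {m : ℕ} (hm : m + 1 < N1) (j : ZMod N1) :
    b (stringE n m) (lnk r j) = if r = n ∧ (j = -1 ∨ j = (m : ZMod N1)) then 1 else 0 := by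
  have h : (m : ZMod N1) ≠ -1 := by
    rw [ne_eq, eq_neg_iff_add_eq_zero]
    intro h
    have := ZMod.val_cast_of_lt hm
    push_cast at this
    rw [h, ZMod.val_zero] at this
    omega
  simp only [b, stringE]
  by_cases h1 : r = n <;> by_cases h2 : j = -1 <;> by_cases h3 : j = (m : ZMod N1) <;>
    simp_all
  all_goals rfl

/-- The inductive step of the row product: a further column adds its bulk term `colExp` and moves
the end term `endExp` one column on. The closing column also removes the terms left at the start of
the string, since `m + 2` is then column 0. -/
lemma expE_add_stringE (hN2 : 2 ≤ N2) (n : ZMod N2) {m : ℕ} (hm : m + 1 < N1)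
    (z : Config N1 N2) :
    expE n ((m : ZMod N1) + 1) (z + stringE n m)
      = if m + 2 = N1 then colExp n ((m : ZMod N1) + 1) z - expE n ((m : ZMod N1) + 2) z
          + colExp n ((m : ZMod N1) + 2) z
          + endExp n ((m : ZMod N1) + 2) z - endExp n m z
        else colExp n ((m : ZMod N1) + 1) z + endExp n ((m : ZMod N1) + 1) z - endExp n m z := by
  have h0 : (m : ZMod N1).val = m := ZMod.val_cast_of_lt (by omega)
  have h1 : ((m : ZMod N1) + 1).val = m + 1 := by exact_mod_cast ZMod.val_cast_of_lt hm
  have e1 : (m : ZMod N1) + 1 + 1 = m + 2 := by ring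
  have e2 : (m : ZMod N1) + 2 - 1 = m + 1 := by ring
  have n1 := add_one_ne hN2 n
  have n2 := add_one_ne hN2 (n + 1)
  have n3 : n + 2 ≠ n + 1 := by rwa [add_assoc, one_add_one_eq_two] at n2
  have m1 := (add_one_ne (by omega : 2 ≤ N1) (m : ZMod N1)).symm
  have m2 : (m : ZMod N1) ≠ -1 := by
    rw [ne_eq, eq_neg_iff_add_eq_zero, ← ZMod.val_eq_zero, h1]
    omega
  have p1 (c : ZMod N1) : b (stringE n m) (lnk (n + 1) c) = 0 := by
    rw [b_stringE_lnk n _ hm, if_neg]; simp [n1]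
  have p2 : b (stringE n m) (lnk n (m : ZMod N1)) = 1 := by
    rw [b_stringE_lnk n _ hm, if_pos]; simp
  have p3 : b (stringE n m) (vtx n (m : ZMod N1)) = 1 := by
    rw [b_stringE_vtx, if_pos]; simp [h0]
  have p4 : b (stringE n m) (vtx (n + 1) (m : ZMod N1)) = 1 := by
    rw [b_stringE_vtx, if_pos]; simp [h0]
  have p5 : b (stringE n m) (vtx n ((m : ZMod N1) + 1)) = 0 := by
    rw [b_stringE_vtx, if_neg]; simp [h1]
  have p6 : b (stringE n m) (vtx (n + 1) ((m : ZMod N1) + 1)) = 0 := by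
    rw [b_stringE_vtx, if_neg]; simp [h1]
  have q (c : ZMod N1) : b (stringE n m) (vtx (n + 2) c)
      = (if n + 2 = n then 1 else 0) * b (stringE n m) (vtx n c) := by
    by_cases h : n + 2 = n
    · simp [h]
    · rw [b_stringE_vtx, if_neg (by simp [h, n3]), if_neg h, zero_mul]
  have q' (c : ZMod N1) : b (stringE n m) (lnk (n + 2) c)
      = (if n + 2 = n then 1 else 0) * b (stringE n m) (lnk n c) := by
    by_cases h : n + 2 = n
    · simp [h]
    · rw [b_stringE_lnk n _ hm, if_neg (by simp [h]), if_neg h, zero_mul]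
  rw [expE_eq n ((m : ZMod N1) + 1)]
  simp only [add_sub_cancel_right, e1, b_add, p1, p2, p3, p4, p5, p6, q, q']
  -- This indicator is 1 exactly for $N_2=2$, when layer `n + 2` is flipped together with layer `n`.
  -- The identity holds for every value of `ν`, so both cases are treated together.
  generalize (if n + 2 = n then (1 : ZMod 4) else 0) = ν
  by_cases hlast : m + 2 = N1
  · have h2 : (m : ZMod N1) + 2 = 0 := by
      exact_mod_cast (by rw [hlast]; simp : ((m + 2 : ℕ) : ZMod N1) = 0)
    have r1 : b (stringE n m) (lnk n ((m : ZMod N1) + 1)) = 1 := by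
      rw [b_stringE_lnk n _ hm, if_pos]
      refine ⟨rfl, Or.inl ?_⟩
      linear_combination h2
    have r2 : b (stringE n m) (vtx n ((m : ZMod N1) + 2)) = 1 := by
      rw [b_stringE_vtx, if_pos]; simp [h2]
    have r3 : b (stringE n m) (vtx (n + 1) ((m : ZMod N1) + 2)) = 1 := by
      rw [b_stringE_vtx, if_pos]; simp [h2]
    simp only [if_pos hlast, r1, r2, r3, expE_eq, colExp, endExp, e1, e2]
    clear * -
    grind
  · have h2 : ((m : ZMod N1) + 2).val = m + 2 := by
      exact_mod_cast ZMod.val_cast_of_lt (show m + 2 < N1 by omega)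
    have r1 : b (stringE n m) (lnk n ((m : ZMod N1) + 1)) = 0 := by
      rw [b_stringE_lnk n _ hm, if_neg]
      rintro ⟨-, h | h⟩
      · have : (m : ZMod N1) + 2 = 0 := by linear_combination h
        rw [this, ZMod.val_zero] at h2
        omega
      · exact m1.symm h
    have r2 : b (stringE n m) (vtx n ((m : ZMod N1) + 2)) = 0 := by
      rw [b_stringE_vtx, if_neg]; simp [h2]
    have r3 : b (stringE n m) (vtx (n + 1) ((m : ZMod N1) + 2)) = 0 := by
      rw [b_stringE_vtx, if_neg]; simp [h2]
    simp only [if_neg hlast, r1, r2, r3, colExp, endExp, e1]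
    clear * -
    grind

/-- The exponent of the product of `S^E` over the first `m + 1` columns of a row. -/
def stringExp (n : ZMod N2) (m : ℕ) (z : Config N1 N2) : ZMod 4 :=
  ∑ i ∈ Finset.range (m + 1), colExp n (i : ZMod N1) z
    + (expE n 0 z - colExp n 0 z - endExp n 0 z) + endExp n (m : ZMod N1) z

lemma map_prod_range (hN2 : 2 ≤ N2) {R : Type} [CommRing R] [Algebra ℂ R]
    (φ : R →ₐ[ℂ] Op N1 N2) {s : ZMod N2 × ZMod N1 → R} (h : ∀ p, φ (s p) = SE p.1 p.2)
    (n : ZMod N2) {m : ℕ} (hm : m + 1 < N1) :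
    φ (∏ i ∈ Finset.range (m + 1), s (n, (i : ZMod N1)))
      = mono (stringE n m) (stringExp n m) := by
  induction m with
  | zero =>
    rw [Finset.prod_range_one, h, SE_eq_mono, Nat.cast_zero, stringE_zero hN2]
    refine mono_congr rfl fun z => ?_
    simp only [stringExp, zero_add, Finset.sum_range_one, Nat.cast_zero]
    ring
  | succ m ih =>
    rw [Finset.prod_range_succ, mul_comm, map_mul, ih (by omega), h, SE_eq_mono, mono_mul,
      Nat.cast_add, Nat.cast_one, flipE_add_stringE hN2 n (by omega)]
    refine mono_congr rfl fun z => ?_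
    rw [expE_add_stringE hN2 n (by omega), if_neg (by omega), stringExp, stringExp,
      Finset.sum_range_succ _ (m + 1), Nat.cast_add, Nat.cast_one]
    ring

lemma rowExp_add_rowExp (n : ZMod N2) (z : Config N1 N2) :
    rowExp n z + rowExp (n + 1) z = ∑ j, colExp n j z := by
  rw [rowExp_eq, rowExp_eq, ← Finset.sum_add_distrib]
  refine Finset.sum_congr rfl fun j _ => ?_
  rw [colExp]
  ring

/-- The product of `S^E` over a row is a product of two Levin-Gu symmetries. -/
lemma map_prod_row (hN1 : 2 ≤ N1) (hN2 : 2 ≤ N2) {R : Type} [CommRing R] [Algebra ℂ R]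
    (φ : R →ₐ[ℂ] Op N1 N2) {s : ZMod N2 × ZMod N1 → R} (h : ∀ p, φ (s p) = SE p.1 p.2)
    (n : ZMod N2) : φ (∏ j, s (n, j)) = levinGu n * levinGu (n + 1) := by
  obtain ⟨m, rfl⟩ : ∃ m, N1 = m + 2 := ⟨N1 - 2, by omega⟩
  have h0 : (m : ZMod (m + 2)) + 2 = 0 := by
    exact_mod_cast ZMod.natCast_self (m + 2)
  rw [zmod_prod_eq_range, Finset.prod_range_succ, mul_comm, map_mul,
    map_prod_range hN2 φ h n (by omega), h, SE_eq_mono, mono_mul, Nat.cast_add, Nat.cast_one,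
    flipE_add_stringE_last hN2 n rfl, levinGu_mul]
  refine mono_congr rfl fun z => ?_
  -- The closing column cancels the start term `expE n 0 z - colExp n 0 z - endExp n 0 z` of
  -- `stringExp` and its end term, so only the sum of `colExp` over the row survives.
  rw [expE_add_stringE hN2 n (by omega), if_pos rfl, rowExp_add_rowExp, zmod_sum_eq_range,
    Finset.sum_range_succ _ (m + 1), stringExp, h0, Nat.cast_add, Nat.cast_one]
  ring

lemma SE_family_commute (hN1 : 2 ≤ N1) (hN2 : 2 ≤ N2) (p q : ZMod N2 × ZMod N1) :
    Commute (SE p.1 p.2 : Op N1 N2) (SE q.1 q.2) :=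
  SE_commute hN1 hN2 _ _ _ _

lemma prodAll_SE (hN1 : 2 ≤ N1) (hN2 : 2 ≤ N2) :
    prodAll (SE : ZMod N2 → ZMod N1 → Op N1 N2) = 1 := by
  obtain ⟨R, _, _, φ, s, -, hs⟩ := exists_commRing (fun p : ZMod N2 × ZMod N1 => SE p.1 p.2)
    (SE_family_commute hN1 hN2)
  obtain ⟨R', _, _, ψ, u, -, hu⟩ := exists_commRing (fun n : ZMod N2 => (levinGu n : Op N1 N2))
    levinGu_commute
  -- The $S^E$ and the $U_n$ are placed in separate commutative algebras, so the row products are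
  -- compared through their images as operators.
  have key : φ (∏ n, ∏ j, s (n, j)) = ψ (∏ n, u n * u (n + 1)) := by
    rw [← Finset.prod_map_toList, ← Finset.prod_map_toList, map_list_prod, map_list_prod,
      List.map_map, List.map_map]
    refine congrArg List.prod (List.map_congr_left fun n _ => ?_)
    simp only [Function.comp_apply]
    rw [map_prod_row hN1 hN2 φ hs, map_mul, hu, hu]
  rw [prodAll_eq_map φ hs, Fintype.prod_prod_type, key, Finset.prod_mul_distrib,
    Fintype.prod_equiv (Equiv.addRight 1) (fun n => u (n + 1)) u fun _ => rfl,
    ← Finset.prod_mul_distrib, ← Finset.prod_map_toList, map_list_prod, List.map_map]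
  refine List.prod_eq_one fun A hA => ?_
  obtain ⟨n, -, rfl⟩ := List.mem_map.1 hA
  rw [Function.comp_apply, map_mul, hu, levinGu_mul_self]

/-! ### Spectra of sums of commuting involutions -/

section Spectrum

variable {V ι : Type*} [AddCommGroup V] [Module ℂ V] [Fintype ι] {S : ι → Module.End ℂ V}

/-- An eigenvector of a sum of commuting involutions can be turned into a joint eigenvector. -/
lemma exists_signs (hS : ∀ i k, Commute (S i) (S k)) (hS2 : ∀ i, S i * S i = 1) {ψ : V}
    (hψ : ψ ≠ 0) {c : ℂ} (hc : (∑ i, S i) ψ = c • ψ) (s : Finset ι) :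
    ∃ (χ : V) (ε : ι → ℤ), χ ≠ 0 ∧ (∑ i, S i) χ = c • χ ∧
      (∀ i, S i ψ = -ψ → S i χ = -χ) ∧ ∀ i ∈ s, (ε i = 1 ∨ ε i = -1) ∧ S i χ = ε i • χ := by
  classical
  induction s using Finset.induction_on with
  | empty => exact ⟨ψ, 0, hψ, hc, fun _ h => h, by simp⟩
  | insert a s ha ih =>
    obtain ⟨χ, ε, hχ, hcχ, hneg, hε⟩ := ih
    have hcomm (i k : ι) (v : V) : S i (S k v) = S k (S i v) := by
      rw [← Module.End.mul_apply, (hS i k).eq, Module.End.mul_apply]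
    have hsum (v : V) : (∑ i, S i) (S a v) = S a ((∑ i, S i) v) := by
      simp only [LinearMap.sum_apply, map_sum, hcomm a]
    have hsq (v : V) : S a (S a v) = v := by
      rw [← Module.End.mul_apply, hS2, Module.End.one_apply]
    -- If `χ` is not already antisymmetric under `S a`, its symmetric part `χ + S a χ` is nonzero
    -- and keeps all relations already arranged, by commutation.
    by_cases h : S a χ = -χ
    · refine ⟨χ, Function.update ε a (-1), hχ, hcχ, hneg, fun i hi => ?_⟩
      rcases Finset.mem_insert.1 hi with rfl | hi
      · simp [h]
      · have : i ≠ a := fun h => ha (h ▸ hi)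
        simpa [this] using hε i hi
    · refine ⟨χ + S a χ, Function.update ε a 1, fun h0 => h (eq_neg_of_add_eq_zero_right h0),
        ?_, fun i hi => ?_, fun i hi => ?_⟩
      · rw [map_add, hsum, hcχ, map_smul, smul_add]
      · rw [map_add, hcomm, hneg i hi, map_neg, neg_add]
      · rcases Finset.mem_insert.1 hi with rfl | hi
        · simp [hsq, add_comm]
        · have : i ≠ a := fun h => ha (h ▸ hi)
          obtain ⟨h1, h2⟩ := hε i hi
          simp only [Function.update_of_ne this]
          refine ⟨h1, ?_⟩
          rw [map_add, hcomm, h2, map_zsmul, smul_add]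

/-- An eigenvalue of a sum of commuting involutions is the number of involutions, or smaller by at
least two; it is smaller if one of the involutions does not fix the eigenvector. -/
lemma eigenvalue_of_sum (hS : ∀ i k, Commute (S i) (S k)) (hS2 : ∀ i, S i * S i = 1) {ψ : V}
    (hψ : ψ ≠ 0) {E : ℝ} (hE : (∑ i, S i) ψ = (E : ℂ) • ψ) :
    (E = Fintype.card ι ∧ ∀ i, S i ψ = ψ) ∨ E ≤ Fintype.card ι - 2 := by
  classical
  have bound {φ : V} (hφ : φ ≠ 0) (hφE : (∑ i, S i) φ = (E : ℂ) • φ) {a : ι}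
      (ha : S a φ = -φ) : E ≤ Fintype.card ι - 2 := by
    obtain ⟨χ, ε, hχ, hcχ, hneg, hε⟩ := exists_signs hS hS2 hφ hφE Finset.univ
    have h1 : ((∑ i, ε i : ℤ) : ℂ) • χ = (E : ℂ) • χ := by
      rw [← hcχ, LinearMap.sum_apply, Int.cast_smul_eq_zsmul, Finset.sum_smul]
      exact Finset.sum_congr rfl fun i _ => ((hε i (Finset.mem_univ i)).2).symm
    have h2 : ((∑ i, ε i : ℤ) : ℝ) = E := by
      exact_mod_cast smul_left_injective ℂ hχ h1
    have h3 : ε a = -1 := by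
      rcases (hε a (Finset.mem_univ a)).1 with h | h
      · have h4 := (hε a (Finset.mem_univ a)).2
        rw [hneg a ha, h, one_smul] at h4
        have h5 : (2 : ℂ) • χ = 0 := by
          rw [two_smul]
          nth_rewrite 1 [← h4]
          exact neg_add_cancel χ
        exact absurd ((smul_eq_zero.1 h5).resolve_left two_ne_zero) hχ
      · exact h
    -- A single sign −1 lowers the maximal sum by 2.
    have h5 : ∑ i, ε i ≤ ∑ i, (1 - if i = a then 2 else 0) := by
      refine Finset.sum_le_sum fun i _ => ?_
      split_ifs with h
      · rw [h, h3]; norm_num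
      · rcases (hε i (Finset.mem_univ i)).1 with h | h <;> rw [h] <;> norm_num
    rw [Finset.sum_sub_distrib, Finset.sum_ite_eq' Finset.univ a] at h5
    simp only [Finset.sum_const, Finset.card_univ, Finset.mem_univ, if_true, nsmul_eq_mul,
      mul_one] at h5
    rw [← h2]
    exact_mod_cast h5
  by_cases hall : ∀ i, S i ψ = ψ
  · refine Or.inl ⟨?_, hall⟩
    have h1 : ((Fintype.card ι : ℕ) : ℂ) • ψ = (E : ℂ) • ψ := by
      rw [← hE, LinearMap.sum_apply, Finset.sum_congr rfl fun i _ => hall i, Finset.sum_const,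
        Finset.card_univ, Nat.cast_smul_eq_nsmul]
    exact_mod_cast (smul_left_injective ℂ hψ h1).symm
  · obtain ⟨a, ha⟩ := not_forall.1 hall
    -- If `S a` does not fix `ψ`, the antisymmetric part `ψ - S a ψ` is a nonzero eigenvector with
    -- the same eigenvalue and sign −1 under `S a`.
    refine Or.inr (bound (φ := ψ - S a ψ) (fun h => ha (sub_eq_zero.1 h).symm) ?_ (a := a) ?_)
    · have hsum : (∑ i, S i) (S a ψ) = S a ((∑ i, S i) ψ) := by
        simp only [LinearMap.sum_apply, map_sum]
        refine Finset.sum_congr rfl fun i _ => ?_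
        rw [← Module.End.mul_apply, (hS i a).eq, Module.End.mul_apply]
      rw [map_sub, hsum, hE, map_smul, smul_sub]
    · rw [map_sub, ← Module.End.mul_apply, hS2, Module.End.one_apply, neg_sub]

end Spectrum

/-! ### Homology of the torus -/

section

variable {N : ℕ} [NeZero N]

lemma zmod_const {α : Type*} {h : ZMod N → α} (hh : ∀ i, h (i + 1) = h i) (i : ZMod N) :
    h i = h 0 := by
  have key (k : ℕ) : h (k : ZMod N) = h 0 := by
    induction k with
    | zero => rw [Nat.cast_zero]
    | succ k ih => rw [Nat.cast_add, Nat.cast_one, hh, ih]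
  simpa using key i.val

/-- Partial sums give a primitive along the cycle; vanishing of the total makes it consistent at the
wrap-around. -/
lemma exists_primitive {g : ZMod N → ZMod 2} (hg : ∑ i, g i = 0) :
    ∃ h : ZMod N → ZMod 2, ∀ i, h i + h (i + 1) = g i := by
  refine ⟨fun i => ∑ k ∈ Finset.range i.val, g (k : ZMod N), fun i => ?_⟩
  have hi := i.val_lt
  have hcast : (i + 1 : ZMod N) = ((i.val + 1 : ℕ) : ZMod N) := by simp
  have hsucc := Finset.sum_range_succ (fun k : ℕ => g (k : ZMod N)) i.val
  rw [ZMod.natCast_zmod_val] at hsucc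
  by_cases hlt : i.val + 1 < N
  · simp only [hcast, ZMod.val_cast_of_lt hlt, hsucc]
    rw [← add_assoc, CharTwo.add_self_eq_zero, zero_add]
  · have hN : i.val + 1 = N := by omega
    rw [hN, ← zmod_sum_eq_range, hg] at hsucc
    simp only [hcast, hN, ZMod.natCast_self, ZMod.val_zero, Finset.range_zero, Finset.sum_empty,
      add_zero]
    grind

end

section

/-- The parity of the matter qubits in a column. -/
def colParity (j : ZMod N1) (z : Config N1 N2) : ZMod 2 := ∑ n : ZMod N2, z (vtx n j)

/-- The parity of the gauge qubits in a row. -/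
def rowParity (n : ZMod N2) (z : Config N1 N2) : ZMod 2 := ∑ j : ZMod N1, z (lnk n j)

lemma colParity_add (j : ZMod N1) (z s : Config N1 N2) :
    colParity j (z + s) = colParity j z + colParity j s := Finset.sum_add_distrib

lemma rowParity_add (n : ZMod N2) (z s : Config N1 N2) :
    rowParity n (z + s) = rowParity n z + rowParity n s := Finset.sum_add_distrib

lemma colParity_boundary (j : ZMod N1) (a : ZMod N2 × ZMod N1 → ZMod 2) :
    colParity j (boundary a) = 0 := by
  simp only [colParity, boundary, Finset.sum_add_distrib]
  rw [Fintype.sum_equiv (Equiv.subRight 1) (fun n : ZMod N2 => a (n - 1, j)) (fun n => a (n, j))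
    fun _ => rfl, CharTwo.add_self_eq_zero]

lemma rowParity_boundary (n : ZMod N2) (a : ZMod N2 × ZMod N1 → ZMod 2) :
    rowParity n (boundary a) = 0 := by
  simp only [rowParity, boundary, Finset.sum_add_distrib]
  rw [Fintype.sum_equiv (Equiv.addRight 1) (fun j : ZMod N1 => a (n, j + 1)) (fun j => a (n, j))
    fun _ => rfl, CharTwo.add_self_eq_zero]

/-- Vanishing on gauge qubits makes `a` constant along rows, and vanishing on matter qubits makes it
constant across rows. -/
lemma boundary_eq_zero {a : ZMod N2 × ZMod N1 → ZMod 2} (h : boundary a = (0 : Config N1 N2))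
    (p : ZMod N2 × ZMod N1) : a p = a 0 := by
  obtain ⟨n, j⟩ := p
  have h1 (n : ZMod N2) (j : ZMod N1) : a (n, j + 1) = a (n, j) := by
    have := congrFun h (lnk n j)
    simp only [boundary, Pi.zero_apply] at this
    grind
  have h2 (n : ZMod N2) (j : ZMod N1) : a (n + 1, j) = a (n, j) := by
    have := congrFun h (vtx (n + 1) j)
    simp only [boundary, Pi.zero_apply, add_sub_cancel_right] at this
    grind
  rw [zmod_const (h := fun j => a (n, j)) (h1 n) j, zmod_const (h := fun n => a (n, 0))
    (fun n => h2 n 0) n]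
  rfl

/-- Summing the face conditions along a row shows that `rowParity` is the same in all rows, so each
gauge row has a primitive `h n`. The matter values left over are constant along rows, and these
constants are integrated in the layer direction by `k`, the obstruction being `colParity`. -/
lemma exists_boundary {z : Config N1 N2} (hz : ∀ n j, face n j z = 0) (hc : colParity 0 z = 0)
    (hr : rowParity 0 z = 0) : ∃ a, z = boundary a := by
  have hr' (n : ZMod N2) : rowParity n z = 0 := by
    rw [← hr]
    refine zmod_const (h := fun n => rowParity n z) (fun n => ?_) n
    have h0 : ∑ j, face (n + 1) j z = 0 := Finset.sum_eq_zero fun j _ => hz _ j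
    simp only [face, Finset.sum_add_distrib, add_sub_cancel_right] at h0
    rw [Fintype.sum_equiv (Equiv.addRight 1) (fun j : ZMod N1 => z (vtx (n + 1) (j + 1)))
      (fun j => z (vtx (n + 1) j)) fun _ => rfl, CharTwo.add_self_eq_zero, zero_add] at h0
    exact (CharTwo.add_eq_zero.1 h0).symm
  choose h hh using fun n => exists_primitive (hr' n)
  have hd (n : ZMod N2) (j : ZMod N1) :
      z (vtx n j) + h n j + h (n - 1) j = z (vtx n 0) + h n 0 + h (n - 1) 0 := by
    refine zmod_const (h := fun j => z (vtx n j) + h n j + h (n - 1) j) (fun j => ?_) j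
    have h1 := hz n j
    have h2 := hh n j
    have h3 := hh (n - 1) j
    simp only [face] at h1
    grind
  obtain ⟨k, hk⟩ := exists_primitive
    (g := fun n : ZMod N2 => z (vtx (n + 1) 0) + h (n + 1) 0 + h n 0) (by
      rw [Finset.sum_add_distrib, Finset.sum_add_distrib,
        Fintype.sum_equiv (Equiv.addRight 1) (fun n : ZMod N2 => z (vtx (n + 1) 0))
          (fun n => z (vtx n 0)) fun _ => rfl,
        Fintype.sum_equiv (Equiv.addRight 1) (fun n : ZMod N2 => h (n + 1) 0)
          (fun n => h n 0) fun _ => rfl, add_assoc, CharTwo.add_self_eq_zero, add_zero]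
      exact hc)
  refine ⟨fun p => h p.1 p.2 + k p.1, ?_⟩
  ext (⟨n, j⟩ | ⟨n, j⟩)
  · have h1 := hd n j
    have h2 := hk (n - 1)
    simp only [sub_add_cancel] at h2
    simp only [boundary]
    grind
  · have h1 := hh n j
    simp only [boundary]
    grind

/-! ### Loop representatives of the homology classes -/

lemma sum_lnk_apply (j₀ : ZMod N1) (m : ZMod N2) (i : ZMod N1) :
    (∑ n : ZMod N2, e (lnk n j₀) : Config N1 N2) (lnk m i) = if i = j₀ then 1 else 0 := by
  rw [Finset.sum_apply]
  by_cases h : i = j₀ <;> simp [Pi.single_apply, h]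

lemma sum_lnk_apply_vtx (j₀ : ZMod N1) (m : ZMod N2) (i : ZMod N1) :
    (∑ n : ZMod N2, e (lnk n j₀) : Config N1 N2) (vtx m i) = 0 := by
  simp [Finset.sum_apply]

lemma loopConfig_vtx (n₀ n : ZMod N2) (j₀ j : ZMod N1) (x y : ZMod 2) :
    loopConfig n₀ j₀ x y (vtx n j) = if n = n₀ then x else 0 := by
  rw [loopConfig, sum_vtx_eq_rowFlip, Pi.add_apply, Pi.smul_apply, Pi.smul_apply,
    sum_lnk_apply_vtx]
  simp [rowFlip]

lemma loopConfig_lnk (n₀ n : ZMod N2) (j₀ j : ZMod N1) (x y : ZMod 2) :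
    loopConfig n₀ j₀ x y (lnk n j) = if j = j₀ then y else 0 := by
  rw [loopConfig, sum_vtx_eq_rowFlip, Pi.add_apply, Pi.smul_apply, Pi.smul_apply,
    sum_lnk_apply]
  simp [rowFlip]

lemma colParity_loopConfig (n₀ : ZMod N2) (j₀ j : ZMod N1) (x y : ZMod 2) :
    colParity j (loopConfig n₀ j₀ x y) = x := by
  simp [colParity, loopConfig_vtx]

lemma rowParity_loopConfig (n₀ n : ZMod N2) (j₀ : ZMod N1) (x y : ZMod 2) :
    rowParity n (loopConfig n₀ j₀ x y) = y := by
  simp [rowParity, loopConfig_lnk]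

lemma face_loopConfig (n₀ n : ZMod N2) (j₀ j : ZMod N1) (x y : ZMod 2) :
    face n j (loopConfig n₀ j₀ x y) = 0 := by
  simp only [face, loopConfig_vtx, loopConfig_lnk]
  grind

/-- A closed configuration is a configuration of non-contractible loops, up to boundaries. -/
lemma exists_loopConfig_add_boundary (n₀ : ZMod N2) (j₀ : ZMod N1) {z : Config N1 N2}
    (hz : ∀ n j, face n j z = 0) : ∃ x y a, z = loopConfig n₀ j₀ x y + boundary a := by
  have hsub : z = loopConfig n₀ j₀ (colParity 0 z) (rowParity 0 z)
      + (z + loopConfig n₀ j₀ (colParity 0 z) (rowParity 0 z)) := by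
    rw [add_comm, config_add_add_cancel]
  obtain ⟨a, ha⟩ := exists_boundary
    (z := z + loopConfig n₀ j₀ (colParity 0 z) (rowParity 0 z))
    (fun n j => by rw [face_add, hz, face_loopConfig, add_zero])
    (by rw [colParity_add, colParity_loopConfig, CharTwo.add_self_eq_zero])
    (by rw [rowParity_add, rowParity_loopConfig, CharTwo.add_self_eq_zero])
  exact ⟨_, _, a, ha ▸ hsub⟩

lemma sum_flipE (A : Finset (ZMod N2 × ZMod N1)) :
    ∑ p ∈ A, flipE p.1 p.2 = boundary fun p => if p ∈ A then 1 else 0 := by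
  have h1 : ∑ p ∈ A, flipE p.1 p.2
      = AddMonoidHom.mk' boundary boundary_add (∑ p ∈ A, Pi.single p 1) := by
    rw [map_sum]
    exact Finset.sum_congr rfl fun p _ => flipE_eq_boundary p.1 p.2
  rw [h1, AddMonoidHom.mk'_apply]
  congr 1
  ext p
  simp [Finset.sum_apply, Pi.single_apply]

lemma exists_finset_boundary (a : ZMod N2 × ZMod N1 → ZMod 2) :
    ∃ A : Finset (ZMod N2 × ZMod N1), boundary a = ∑ p ∈ A, flipE p.1 p.2 := by
  refine ⟨Finset.univ.filter fun p => a p = 1, ?_⟩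
  rw [sum_flipE]
  congr 1
  ext p
  have h : a p = 0 ∨ a p = 1 := by generalize a p = x; revert x; decide
  rcases h with h | h <;> simp [h]

lemma sum_flipE_eq_zero {A : Finset (ZMod N2 × ZMod N1)}
    (h : ∑ p ∈ A, flipE p.1 p.2 = (0 : Config N1 N2)) : A = ∅ ∨ A = Finset.univ := by
  rw [sum_flipE] at h
  have hconst := boundary_eq_zero h
  by_cases h0 : (0 : ZMod N2 × ZMod N1) ∈ A
  · right
    ext p
    have := hconst p
    simp only [h0, if_true] at this
    by_contra hp
    simp_all
  · left
    ext p
    have := hconst p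
    simp only [h0, if_false] at this
    by_contra hp
    simp_all

end

/-! ### The stabilizer projection -/

lemma hilb_sum_apply {ι : Type*} (s : Finset ι) (f : ι → Hilb N1 N2) (z : Config N1 N2) :
    (∑ i ∈ s, f i) z = ∑ i ∈ s, f i z := by
  rw [WithLp.ofLp_sum, Finset.sum_apply]

/-- The product of the projections `(1 + S^E) / 2`. -/
noncomputable def projE (N1 N2 : ℕ) [NeZero N1] [NeZero N2] : Op N1 N2 :=
  prodAll fun n j => (2⁻¹ : ℂ) • (1 + SE n j)

/-- All stabilizers. -/
noncomputable def stab : (ZMod N2 × ZMod N1) ⊕ (ZMod N2 × ZMod N1) → Op N1 N2 :=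
  Sum.elim (fun p => SE p.1 p.2) fun p => SM p.1 p.2

lemma stab_commute (hN1 : 2 ≤ N1) (hN2 : 2 ≤ N2)
    (p q : (ZMod N2 × ZMod N1) ⊕ (ZMod N2 × ZMod N1)) :
    Commute (stab p : Op N1 N2) (stab q) := by
  obtain p | p := p <;> obtain q | q := q
  · exact SE_commute hN1 hN2 _ _ _ _
  · exact SE_commute_SM _ _ _ _
  · exact (SE_commute_SM _ _ _ _).symm
  · exact SM_commute _ _ _ _

lemma stab_mul_self (hN1 : 2 ≤ N1) (hN2 : 2 ≤ N2)
    (p : (ZMod N2 × ZMod N1) ⊕ (ZMod N2 × ZMod N1)) : stab p * stab p = (1 : Op N1 N2) := by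
  obtain p | p := p
  · exact SE_mul_self hN1 hN2 _ _
  · exact SM_mul_self _ _

/-- A commutative algebra containing all stabilizers. -/
lemma exists_stab_ring (hN1 : 2 ≤ N1) (hN2 : 2 ≤ N2) :
    ∃ (R : Type) (_ : CommRing R) (_ : Algebra ℂ R) (φ : R →ₐ[ℂ] Op N1 N2)
      (s t : ZMod N2 × ZMod N1 → R), Function.Injective φ ∧ (∀ p, φ (s p) = SE p.1 p.2) ∧
      (∀ p, φ (t p) = SM p.1 p.2) ∧
      projE N1 N2 = φ (∏ p, (2⁻¹ : ℂ) • (1 + s p)) := by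
  obtain ⟨R, i1, i2, φ, s, hinj, hs⟩ := exists_commRing (stab : _ → Op N1 N2)
    (stab_commute hN1 hN2)
  refine ⟨R, i1, i2, φ, fun p => s (Sum.inl p), fun p => s (Sum.inr p), hinj,
    fun p => hs (Sum.inl p), fun p => hs (Sum.inr p), prodAll_eq_map φ fun p => ?_⟩
  rw [map_smul, map_add, map_one, hs]
  rfl

lemma SE_mul_projE (hN1 : 2 ≤ N1) (hN2 : 2 ≤ N2) (n : ZMod N2) (j : ZMod N1) :
    SE n j * projE N1 N2 = projE N1 N2 ∧ projE N1 N2 * SE n j = projE N1 N2 := by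
  obtain ⟨R, _, _, φ, s, t, hinj, hs, ht, hproj⟩ := exists_stab_ring hN1 hN2
  have hsq : s (n, j) * s (n, j) = 1 := by
    apply hinj
    rw [map_mul, hs, SE_mul_self hN1 hN2, map_one]
  have key : s (n, j) * ∏ p, (2⁻¹ : ℂ) • (1 + s p) = ∏ p, (2⁻¹ : ℂ) • (1 + s p) := by
    rw [← Finset.mul_prod_erase _ _ (Finset.mem_univ (n, j)), ← mul_assoc, mul_smul_comm,
      mul_add, mul_one, hsq, add_comm (s (n, j))]
  have hs' : SE n j = φ (s (n, j)) := (hs (n, j)).symm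
  rw [hproj, hs', ← map_mul, ← map_mul, mul_comm _ (s (n, j)), key]
  exact ⟨rfl, rfl⟩

lemma SM_commute_projE (hN1 : 2 ≤ N1) (hN2 : 2 ≤ N2) (n : ZMod N2) (j : ZMod N1) :
    Commute (SM n j) (projE N1 N2) := by
  obtain ⟨R, _, _, φ, s, t, hinj, hs, ht, hproj⟩ := exists_stab_ring hN1 hN2
  have ht' : SM n j = φ (t (n, j)) := (ht (n, j)).symm
  rw [hproj, ht']
  exact (Commute.all _ _).map φ

lemma mem_gaussSpace {ψ : Hilb N1 N2} : ψ ∈ gaussSpace N1 N2 ↔ ∀ n j, SE n j ψ = ψ := by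
  simp [gaussSpace, sub_eq_zero]

lemma mem_stabSpace {ψ : Hilb N1 N2} : ψ ∈ stabSpace N1 N2 ↔
    (∀ n j, SE n j ψ = ψ) ∧ ∀ n j, SM n j ψ = ψ := by
  simp [stabSpace, mem_gaussSpace, sub_eq_zero]

lemma projE_apply_of_mem (hN1 : 2 ≤ N1) (hN2 : 2 ≤ N2) {ψ : Hilb N1 N2}
    (hψ : ∀ n j, SE n j ψ = ψ) : projE N1 N2 ψ = ψ := by
  obtain ⟨R, _, _, φ, s, t, hinj, hs, ht, hproj⟩ := exists_stab_ring hN1 hN2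
  rw [hproj]
  refine Finset.prod_induction (fun p => (2⁻¹ : ℂ) • (1 + s p)) (fun r => φ r ψ = ψ) ?_ ?_ ?_
  · intro x y hx hy
    rw [map_mul, Module.End.mul_apply, hy, hx]
  · rw [map_one, Module.End.one_apply]
  · intro p _
    rw [map_smul, map_add, map_one, hs, LinearMap.smul_apply, LinearMap.add_apply, hψ,
      Module.End.one_apply, ← two_smul ℂ ψ, smul_smul]
    norm_num

lemma SM_ket {z : Config N1 N2} {n : ZMod N2} {j : ZMod N1} (hz : face n j z = 0) :
    SM n j (ket z) = ket z := by
  rw [SM_eq_mono, mono_ket, hz, add_zero]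
  simp

lemma face_eq_zero_of_SM {ψ : Hilb N1 N2} {n : ZMod N2} {j : ZMod N1} (hψ : SM n j ψ = ψ)
    {z : Config N1 N2} (hz : ψ z ≠ 0) : face n j z = 0 := by
  by_contra h
  have h1 : face n j z = 1 := by
    revert h; generalize face n j z = x; revert x; decide
  have h2 : SM n j ψ z = ψ z := by rw [hψ]
  have h3 : (2 * (((1 : ZMod 2).val : ℕ) : ZMod 4)).val = 2 := by decide
  rw [SM_eq_mono, mono_apply, add_zero, h1, h3, Complex.I_sq] at h2
  have h4 : (2 : ℂ) * ψ z = 0 := by linear_combination -h2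
  exact hz ((mul_eq_zero.1 h4).resolve_left two_ne_zero)

/-- A product of `S^E` is monomial. -/
lemma exists_mono_prod {R : Type} [CommRing R] [Algebra ℂ R]
    (φ : R →ₐ[ℂ] Op N1 N2) {s : ZMod N2 × ZMod N1 → R} (hs : ∀ p, φ (s p) = SE p.1 p.2)
    (A : Finset (ZMod N2 × ZMod N1)) :
    ∃ f, φ (∏ p ∈ A, s p) = mono (∑ p ∈ A, flipE p.1 p.2) f := by
  classical
  induction A using Finset.induction_on with
  | empty => exact ⟨0, by rw [Finset.prod_empty, map_one, Finset.sum_empty, mono_zero_zero]⟩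
  | insert a A ha ih =>
    obtain ⟨f, hf⟩ := ih
    refine ⟨fun z => f z + expE a.1 a.2 (z + ∑ p ∈ A, flipE p.1 p.2), ?_⟩
    rw [Finset.prod_insert ha, Finset.sum_insert ha, map_mul, hf, hs, SE_eq_mono, mono_mul]

/-- `projE` absorbs every $S^E$, and $S^E$ moves a basis state by its flip up to a power of `i`.
Projected states thus depend, up to scalars, only on the class modulo boundaries. -/
lemma projE_ket_add_boundary (hN1 : 2 ≤ N1) (hN2 : 2 ≤ N2) (z : Config N1 N2)
    (a : ZMod N2 × ZMod N1 → ZMod 2) :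
    ∃ c : ℂ, projE N1 N2 (ket (z + boundary a)) = c • projE N1 N2 (ket z) := by
  obtain ⟨A, hA⟩ := exists_finset_boundary a
  rw [hA]
  clear hA
  classical
  induction A using Finset.induction_on with
  | empty => exact ⟨1, by rw [Finset.sum_empty, add_zero, one_smul]⟩
  | insert p A hp ih =>
    obtain ⟨c, hc⟩ := ih
    set w := z + ∑ p ∈ A, flipE p.1 p.2
    have h1 : projE N1 N2 (SE p.1 p.2 (ket w)) = projE N1 N2 (ket w) := by
      rw [← Module.End.mul_apply, (SE_mul_projE hN1 hN2 _ _).2]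
    rw [SE_eq_mono, mono_ket, map_smul] at h1
    refine ⟨(Complex.I ^ (expE p.1 p.2 w).val)⁻¹ * c, ?_⟩
    rw [Finset.sum_insert hp, add_comm (flipE p.1 p.2), ← add_assoc, mul_smul, ← hc, ← h1,
      smul_smul, inv_mul_cancel₀ (pow_ne_zero _ Complex.I_ne_zero), one_smul]

/-- Expanding the projection over sets of positions, only the empty and the full set return `z` to
itself. Both contribute $+1$, the full one because the product of all $S^E$ is $1$; with $-1$ the
projection would vanish here. -/
lemma projE_ket_self (hN1 : 2 ≤ N1) (hN2 : 2 ≤ N2) (z : Config N1 N2) :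
    projE N1 N2 (ket z) z ≠ 0 := by
  obtain ⟨R, _, _, φ, s, t, hinj, hs, ht, hproj⟩ := exists_stab_ring hN1 hN2
  choose f hf using exists_mono_prod φ hs
  have hprod : φ (∏ p, s p) = 1 := by rw [← prodAll_eq_map φ hs, prodAll_SE hN1 hN2]
  have happ (A : Finset (ZMod N2 × ZMod N1)) : φ (∏ p ∈ A, s p) (ket z) z
      = if A = ∅ then 1 else if A = Finset.univ then 1 else 0 := by
    split_ifs with h1 h2
    · rw [h1, Finset.prod_empty, map_one, Module.End.one_apply, ket_apply, if_pos rfl]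
    · rw [h2, hprod, Module.End.one_apply, ket_apply, if_pos rfl]
    · rw [hf, mono_ket, PiLp.smul_apply, ket_apply, if_neg, smul_zero]
      intro h
      rcases sum_flipE_eq_zero (left_eq_add.1 h) with h | h
      · exact h1 h
      · exact h2 h
  rw [hproj, Finset.prod_smul, Finset.prod_one_add, map_smul, map_sum, LinearMap.smul_apply,
    LinearMap.sum_apply, PiLp.smul_apply, hilb_sum_apply, Finset.powerset_univ,
    Finset.sum_congr rfl fun A _ => happ A]
  have hne : (Finset.univ : Finset (ZMod N2 × ZMod N1)) ≠ ∅ := Finset.univ_nonempty.ne_empty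
  rw [← Finset.add_sum_erase _ _ (Finset.mem_univ ∅), ← Finset.add_sum_erase _ _
    (Finset.mem_erase.2 ⟨hne, Finset.mem_univ Finset.univ⟩), if_pos rfl, if_neg hne, if_pos rfl,
    Finset.sum_eq_zero]
  · simp
  · intro A hA
    simp only [Finset.mem_erase] at hA
    rw [if_neg hA.2.1, if_neg hA.1]

lemma projE_ket_apply_eq_zero (hN1 : 2 ≤ N1) (hN2 : 2 ≤ N2) {z w : Config N1 N2}
    (h : ∀ a, w ≠ z + boundary a) : projE N1 N2 (ket z) w = 0 := by
  obtain ⟨R, _, _, φ, s, t, hinj, hs, ht, hproj⟩ := exists_stab_ring hN1 hN2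
  choose f hf using exists_mono_prod φ hs
  rw [hproj, Finset.prod_smul, Finset.prod_one_add, map_smul, map_sum, LinearMap.smul_apply,
    LinearMap.sum_apply, PiLp.smul_apply, hilb_sum_apply, Finset.sum_eq_zero, smul_zero]
  intro A _
  rw [hf, mono_ket, PiLp.smul_apply, ket_apply, if_neg, smul_zero]
  rw [sum_flipE]
  exact h _

/-! ### The ground states -/

lemma loopState_eq (n₀ : ZMod N2) (j₀ : ZMod N1) (p : ZMod 2 × ZMod 2) :
    loopState n₀ j₀ p = projE N1 N2 (ket (loopConfig n₀ j₀ p.1 p.2)) := rfl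

lemma loopState_mem_stabSpace (hN1 : 2 ≤ N1) (hN2 : 2 ≤ N2) (n₀ : ZMod N2) (j₀ : ZMod N1)
    (p : ZMod 2 × ZMod 2) : loopState n₀ j₀ p ∈ stabSpace N1 N2 := by
  rw [mem_stabSpace, loopState_eq]
  refine ⟨fun n j => ?_, fun n j => ?_⟩
  · rw [← Module.End.mul_apply, (SE_mul_projE hN1 hN2 n j).1]
  · rw [← Module.End.mul_apply, (SM_commute_projE hN1 hN2 n j).eq, Module.End.mul_apply,
      SM_ket (face_loopConfig _ _ _ _ _ _)]

/-- The projected loop states have disjoint supports: column and row parities are unchanged by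
boundaries and distinguish the four classes. -/
lemma linearIndependent_loopState (hN1 : 2 ≤ N1) (hN2 : 2 ≤ N2) (n₀ : ZMod N2)
    (j₀ : ZMod N1) : LinearIndependent ℂ (loopState n₀ j₀ : _ → Hilb N1 N2) := by
  rw [Fintype.linearIndependent_iff]
  intro g hg q
  have h0 : (∑ p, g p • loopState n₀ j₀ p : Hilb N1 N2) (loopConfig n₀ j₀ q.1 q.2) = 0 := by
    rw [hg]; rfl
  rw [hilb_sum_apply, Finset.sum_eq_single q] at h0
  · rw [PiLp.smul_apply, loopState_eq, smul_eq_mul] at h0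
    exact (mul_eq_zero.1 h0).resolve_right (projE_ket_self hN1 hN2 _)
  · intro p _ hpq
    rw [PiLp.smul_apply, loopState_eq, projE_ket_apply_eq_zero hN1 hN2, smul_zero]
    intro a ha
    refine hpq (Prod.ext ?_ ?_)
    · have := congrArg (colParity 0) ha
      rw [colParity_add, colParity_boundary, colParity_loopConfig, colParity_loopConfig,
        add_zero] at this
      exact this.symm
    · have := congrArg (rowParity 0) ha
      rw [rowParity_add, rowParity_boundary, rowParity_loopConfig, rowParity_loopConfig,
        add_zero] at this
      exact this.symm
  · exact fun h => absurd (Finset.mem_univ q) h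

lemma eq_sum_ket (ψ : Hilb N1 N2) : ψ = ∑ z, ψ z • ket z := by
  ext w
  rw [hilb_sum_apply]
  simp [ket_apply]

/-- A stabilized state equals its own projection and is supported on closed configurations, so it is
a combination of projected closed basis states; each of these is proportional to a loop state. -/
lemma span_loopState (hN1 : 2 ≤ N1) (hN2 : 2 ≤ N2) (n₀ : ZMod N2) (j₀ : ZMod N1) :
    Submodule.span ℂ (Set.range (loopState n₀ j₀)) = stabSpace N1 N2 := by
  refine le_antisymm (Submodule.span_le.2 ?_) fun ψ hψ => ?_
  · rintro _ ⟨p, rfl⟩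
    exact loopState_mem_stabSpace hN1 hN2 n₀ j₀ p
  · rw [mem_stabSpace] at hψ
    rw [← projE_apply_of_mem hN1 hN2 hψ.1, eq_sum_ket ψ, map_sum]
    refine Submodule.sum_mem _ fun z _ => ?_
    rw [map_smul]
    by_cases hz : ψ z = 0
    · rw [hz, zero_smul]
      exact Submodule.zero_mem _
    · obtain ⟨x, y, a, rfl⟩ := exists_loopConfig_add_boundary n₀ j₀
        fun n j => face_eq_zero_of_SM (hψ.2 n j) hz
      obtain ⟨c, hc⟩ := projE_ket_add_boundary hN1 hN2 (loopConfig n₀ j₀ x y) a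
      rw [hc]
      exact Submodule.smul_mem _ _ (Submodule.smul_mem _ _
        (Submodule.subset_span ⟨(x, y), rfl⟩))

lemma finrank_stabSpace (hN1 : 2 ≤ N1) (hN2 : 2 ≤ N2) :
    Module.finrank ℂ (stabSpace N1 N2) = 4 := by
  rw [← span_loopState hN1 hN2 0 0,
    finrank_span_eq_card (linearIndependent_loopState hN1 hN2 0 0)]
  rfl

/-! ### Energies -/

lemma ham_eq : ham N1 N2 = -∑ p, stab p := by
  rw [ham, Fintype.sum_sum_type, Fintype.sum_prod_type, Fintype.sum_prod_type,
    ← Finset.sum_add_distrib]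
  simp only [Finset.sum_add_distrib]
  rfl

lemma hamTilde_eq : hamTilde N1 N2 = -∑ p : ZMod N2 × ZMod N1, SM p.1 p.2 := by
  rw [hamTilde, Fintype.sum_prod_type]

lemma card_positions : (Fintype.card (ZMod N2 × ZMod N1) : ℝ) = (N1 : ℝ) * N2 := by
  rw [Fintype.card_prod, ZMod.card, ZMod.card]
  push_cast
  ring

section

variable {ι : Type*} [Fintype ι] {S : ι → Op N1 N2} {P : Submodule ℂ (Hilb N1 N2)}

/-- Ground states of a sum of commuting involutions with a common fixed vector. -/
lemma energies_of_involutions (hS : ∀ i k, Commute (S i) (S k)) (hS2 : ∀ i, S i * S i = 1)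
    {ψ : Hilb N1 N2} (hψ : ψ ≠ 0) (hP : ψ ∈ P) (hfix : ∀ i, S i ψ = ψ) {c : ℝ}
    (hc : (Fintype.card ι : ℝ) = c) :
    IsLeast (energies (-∑ i, S i) P) (-c) ∧
      (∀ χ, χ ∈ energySpace (-∑ i, S i) P (-c) ↔ χ ∈ P ∧ ∀ i, S i χ = χ) ∧
      ∀ E ∈ energies (-∑ i, S i) P, E ≠ -c → -c + 2 ≤ E := by
  have hneg {χ : Hilb N1 N2} {E : ℝ} :
      (-∑ i, S i) χ = (E : ℂ) • χ ↔ (∑ i, S i) χ = ((-E : ℝ) : ℂ) • χ := by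
    rw [LinearMap.neg_apply, neg_eq_iff_eq_neg, Complex.ofReal_neg, neg_smul]
  have hmem {χ : Hilb N1 N2} (hχ : ∀ i, S i χ = χ) :
      (-∑ i, S i) χ = ((-c : ℝ) : ℂ) • χ := by
    rw [hneg, neg_neg, ← hc, LinearMap.sum_apply, Finset.sum_congr rfl fun i _ => hχ i,
      Finset.sum_const, Finset.card_univ, Complex.ofReal_natCast, Nat.cast_smul_eq_nsmul]
  have hcases {E : ℝ} {χ : Hilb N1 N2} (hχ : χ ≠ 0) (hE : (-∑ i, S i) χ = (E : ℂ) • χ) :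
      (E = -c ∧ ∀ i, S i χ = χ) ∨ -c + 2 ≤ E := by
    rcases eigenvalue_of_sum hS hS2 hχ (hneg.1 hE) with ⟨h1, h2⟩ | h
    · exact Or.inl ⟨by linarith, h2⟩
    · exact Or.inr (by linarith)
  refine ⟨⟨⟨ψ, hP, hψ, hmem hfix⟩, ?_⟩, fun χ => ⟨?_, ?_⟩, ?_⟩
  · rintro E ⟨χ, -, hχ, hE⟩
    rcases hcases hχ hE with h | h
    · exact h.1.ge
    · linarith
  · rintro ⟨h1, h2⟩
    refine ⟨h1, ?_⟩
    by_cases h0 : χ = 0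
    · simp [h0]
    rcases hcases h0 (Module.End.mem_eigenspace_iff.1 h2) with h | h
    · exact h.2
    · linarith
  · rintro ⟨h1, h2⟩
    exact ⟨h1, Module.End.mem_eigenspace_iff.2 (hmem h2)⟩
  · rintro E ⟨χ, -, hχ, hE⟩ hne
    exact (hcases hχ hE).resolve_left fun h => hne h.1

end

lemma loopState_ne_zero (hN1 : 2 ≤ N1) (hN2 : 2 ≤ N2) :
    (loopState 0 0 0 : Hilb N1 N2) ≠ 0 :=
  (linearIndependent_loopState hN1 hN2 0 0).ne_zero 0

lemma energies_hamTilde (hN1 : 2 ≤ N1) (hN2 : 2 ≤ N2) :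
    IsLeast (energies (hamTilde N1 N2) (gaussSpace N1 N2)) (-((N1 : ℝ) * N2)) ∧
      energySpace (hamTilde N1 N2) (gaussSpace N1 N2) (-((N1 : ℝ) * N2)) = stabSpace N1 N2 ∧
      ∀ E ∈ energies (hamTilde N1 N2) (gaussSpace N1 N2),
        E ≠ -((N1 : ℝ) * N2) → -((N1 : ℝ) * N2) + 2 ≤ E := by
  have hmem := mem_stabSpace.1 (loopState_mem_stabSpace hN1 hN2 (0 : ZMod N2) (0 : ZMod N1) 0)
  obtain ⟨h1, h2, h3⟩ := energies_of_involutions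
    (S := fun p : ZMod N2 × ZMod N1 => (SM p.1 p.2 : Op N1 N2))
    (fun _ _ => SM_commute _ _ _ _) (fun _ => SM_mul_self _ _) (loopState_ne_zero hN1 hN2)
    (mem_gaussSpace.2 hmem.1) (fun p => hmem.2 p.1 p.2) card_positions
  rw [hamTilde_eq]
  refine ⟨h1, Submodule.ext fun χ => ?_, h3⟩
  rw [h2, mem_gaussSpace, mem_stabSpace, Prod.forall]

lemma energies_ham (hN1 : 2 ≤ N1) (hN2 : 2 ≤ N2) :
    IsLeast (energies (ham N1 N2) ⊤) (-(2 * (N1 : ℝ) * N2)) ∧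
      energySpace (ham N1 N2) ⊤ (-(2 * (N1 : ℝ) * N2)) = stabSpace N1 N2 ∧
      ∀ E ∈ energies (ham N1 N2) ⊤,
        E ≠ -(2 * (N1 : ℝ) * N2) → -(2 * (N1 : ℝ) * N2) + 2 ≤ E := by
  have hmem := mem_stabSpace.1 (loopState_mem_stabSpace hN1 hN2 (0 : ZMod N2) (0 : ZMod N1) 0)
  obtain ⟨h1, h2, h3⟩ := energies_of_involutions (S := (stab : _ → Op N1 N2)) (P := ⊤)
    (stab_commute hN1 hN2) (stab_mul_self hN1 hN2) (loopState_ne_zero hN1 hN2)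
    Submodule.mem_top
    (fun p => Sum.rec (fun p => hmem.1 p.1 p.2) (fun p => hmem.2 p.1 p.2) p)
    (c := 2 * (N1 : ℝ) * N2)
    (by rw [Fintype.card_sum, Nat.cast_add, card_positions]; ring)
  rw [ham_eq]
  refine ⟨h1, Submodule.ext fun χ => ?_, h3⟩
  rw [h2, mem_stabSpace, Sum.forall, Prod.forall, Prod.forall]
  exact ⟨fun h => h.2, fun h => ⟨Submodule.mem_top, h⟩⟩

/-! ### The symmetries under layered gauging -/

lemma b_rowFlip_vtx (r n : ZMod N2) (j : ZMod N1) :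
    b (rowFlip r) (vtx n j) = if n = r then 1 else 0 := by
  simp only [b, rowFlip]
  split_ifs <;> rfl

lemma b_rowFlip_lnk (r n : ZMod N2) (j : ZMod N1) : b (rowFlip r) (lnk n j) = 0 := rfl

lemma mGate_eq_mono (n : ZMod N2) : mGate n = mono (0 : Config N1 N2) (mExp n) :=
  phase_eq_mono _

lemma xiGate_eq_mono (n : ZMod N2) : xiGate n = mono (0 : Config N1 N2) (xiExp n) :=
  phase_eq_mono _

lemma xiGateInv_eq_mono (n : ZMod N2) :
    xiGateInv n = mono (0 : Config N1 N2) fun z => -xiExp n z :=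
  phase_eq_mono _

lemma mono_conj (s : Config N1 N2) (f g h : Config N1 N2 → ZMod 4) :
    mono 0 g * mono s f * mono 0 h = mono s fun z => h z + f z + g (z + s) := by
  rw [mono_mul, mono_mul]
  exact mono_congr (by simp) fun z => by simp only [add_zero]; ring

lemma gauss_eq_mono (n : ZMod N2) (j : ZMod N1) :
    gauss n j = mono (flipE n j) (0 : Config N1 N2 → ZMod 4) := by
  simp only [gauss, pauliX, flipX_eq_mono, mono_mul]
  exact mono_congr rfl fun z => by simp

lemma two_mul_mExp (n : ZMod N2) (z : Config N1 N2) : 2 * mExp n z = 0 := by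
  rw [mExp, Finset.mul_sum]
  refine Finset.sum_eq_zero fun j _ => ?_
  grind

lemma sum_eq_of_telescope {F G : ZMod N1 → ZMod 4} (h : ZMod N1 → ZMod 4)
    (hFG : ∀ j, F j = G j + (h (j + 1) - h j)) : ∑ j, F j = ∑ j, G j := by
  rw [Finset.sum_congr rfl fun j _ => hFG j, Finset.sum_add_distrib, Finset.sum_sub_distrib,
    sum_shift, sub_self, add_zero]

/-- Flipping all corners of a triangle changes its `CCZ` by `CZ` on the edges, `Z` on the corners
and a sign. Diagonals cancel within a square and vertical edges between neighbouring squares,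
leaving the horizontal bonds of the Levin–Gu phases. -/
lemma mExp_add_rows (hN2 : 2 ≤ N2) (n : ZMod N2) (z : Config N1 N2) :
    mExp n (z + (rowFlip n + rowFlip (n + 1))) + mExp n z = rowExp n z + rowExp (n + 1) z := by
  have h1 := add_one_ne hN2 n
  rw [mExp, mExp, rowExp_eq, rowExp_eq, ← Finset.sum_add_distrib, ← Finset.sum_add_distrib]
  -- The telescoping terms are the vertical edge shared by neighbouring squares and the corner that
  -- appears in column `j + 1` instead of `j`.
  refine sum_eq_of_telescope (fun j => 2 * b z (vtx (n + 1) j)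
    + 2 * b z (vtx n j) * b z (vtx (n + 1) j)) fun j => ?_
  simp only [b_add, b_rowFlip_vtx, h1, h1.symm, if_true, if_false]
  clear * -
  grind

lemma mExp_add_row (hN2 : 2 ≤ N2) (n : ZMod N2) (z : Config N1 N2) :
    mExp n (z + rowFlip (n + 1)) + mExp n z = ∑ j : ZMod N1,
      2 * b z (vtx n (j + 1)) * (1 + b z (vtx n j) + b z (vtx (n + 1) j)
        + b z (vtx (n + 1) (j + 1))) := by
  have h1 := add_one_ne hN2 n
  rw [mExp, mExp, ← Finset.sum_add_distrib]
  refine Finset.sum_congr rfl fun j _ => ?_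
  simp only [b_add, b_rowFlip_vtx, h1.symm, if_true, if_false]
  clear * -
  grind

/-- The exponent of the phases of `gaugedU`. -/
def gaugedExp (n : ZMod N2) (z : Config N1 N2) : ZMod 4 :=
  ∑ j : ZMod N1,
    (lExp3 z (vtx n j) (lnk n j) (vtx n (j + 1))
      + lExp3 z (vtx (n + 1) j) (lnk n j) (vtx (n + 1) (j + 1))
      + lExp3 z (vtx (n + 1) j) (lnk n j) (vtx n (j + 1))
      - lExp z (vtx n j) (vtx (n + 1) j))

lemma gaugedU_eq_mono (n : ZMod N2) :
    gaugedU n = mono (rowFlip (n + 1) : Config N1 N2) fun z => 2 + gaugedExp n z := by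
  rw [gaugedU, rowX_eq_mono, phase_eq_mono, mono_mul, neg_mono]
  exact mono_congr (add_zero _) fun z => by simp [gaugedExp]

/-- Undoing the conjugation by $M$ leaves the Levin–Gu phase of row `n + 1` and terms proportional
to the gauge bits. The latter vanish on trivial gauge fields, and otherwise are the terms that $\Xi$
has to remove. -/
lemma gaugedExp_eq (n : ZMod N2) (z : Config N1 N2) :
    gaugedExp n z + ∑ j : ZMod N1, 2 * b z (vtx n (j + 1)) * (1 + b z (vtx n j)
        + b z (vtx (n + 1) j) + b z (vtx (n + 1) (j + 1)))
      = rowExp (n + 1) z + ∑ j : ZMod N1, b z (lnk n j) * (3 + 2 * b z (vtx n j)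
        + 2 * b z (vtx (n + 1) (j + 1))) := by
  rw [gaugedExp, rowExp_eq, ← Finset.sum_add_distrib, ← Finset.sum_add_distrib]
  refine sum_eq_of_telescope (fun j => b z (vtx (n + 1) j)
    + 2 * b z (vtx n j) * b z (vtx (n + 1) j)) fun j => ?_
  simp only [lExp_eq, lExp3_eq]
  grind

lemma lExp_add {z s : Config N1 N2} {a c : Site N1 N2} (h : s a + s c = 0) :
    lExp (z + s) a c = lExp z a c := by
  simp only [lExp, Pi.add_apply]
  rw [add_add_add_comm, h, add_zero]

lemma lExp3_add {z s : Config N1 N2} {a c d : Site N1 N2} (h : s a + s c + s d = 0) :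
    lExp3 (z + s) a c d = lExp3 z a c d := by
  simp only [lExp3, Pi.add_apply]
  rw [show z a + s a + (z c + s c) + (z d + s d) = z a + z c + z d + (s a + s c + s d) by ring, h,
    add_zero]

lemma flipE_vtx (hN2 : 2 ≤ N2) (n : ZMod N2) (i j : ZMod N1) :
    flipE n i (vtx n j) = (if j = i then 1 else 0) ∧
      flipE n i (vtx (n + 1) j) = if j = i then 1 else 0 := by
  have h1 := add_one_ne hN2 n
  constructor <;> simp [flipE, Pi.single_apply, h1, h1.symm]

lemma flipE_vtx_of_ne {n m : ZMod N2} (h : m ≠ n) (h' : m ≠ n + 1) (i j : ZMod N1) :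
    flipE n i (vtx m j) = 0 := by
  simp [flipE, h, h']

lemma flipE_lnk (n : ZMod N2) (i j : ZMod N1) :
    flipE n i (lnk n j) = (if j = i then 1 else 0) + if j + 1 = i then 1 else 0 := by
  simp [flipE, Pi.single_apply, eq_sub_iff_add_eq, add_comm]

lemma flipE_lnk_of_ne {n m : ZMod N2} (h : m ≠ n) (i j : ZMod N1) :
    flipE n i (lnk m j) = 0 := by
  simp [flipE, h]

/-- A Gauss flip meets the sites of every `lExp3` and `lExp` term an even number of times. -/
lemma gaugedU_commute_gauss (hN2 : 2 ≤ N2) (n : ZMod N2) (j : ZMod N1) :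
    Commute (gaugedU n : Op N1 N2) (gauss n j) := by
  rw [gaugedU_eq_mono, gauss_eq_mono]
  refine mono_commute fun z => ?_
  have h : gaugedExp n (z + flipE n j) = gaugedExp n z := by
    refine Finset.sum_congr rfl fun i _ => ?_
    rw [lExp3_add, lExp3_add, lExp3_add, lExp_add] <;>
      simp only [(flipE_vtx hN2 n j _).1, (flipE_vtx hN2 n j _).2, flipE_lnk] <;> grind
  simp [h]

lemma gaugedU_ket (hN2 : 2 ≤ N2) (n : ZMod N2) {z : Config N1 N2}
    (hz : ∀ j : ZMod N1, z (lnk n j) = 0) :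
    gaugedU n (ket z) = (mGate n * levinGu (n + 1) * mGate n : Op N1 N2) (ket z) := by
  rw [gaugedU_eq_mono, mGate_eq_mono, levinGu_eq_mono, mono_conj, mono_ket, mono_ket]
  congr 3
  have h1 := gaugedExp_eq n z
  have h2 := mExp_add_row hN2 n z
  have h3 := two_mul_mExp n z
  have h4 := two_mul_mExp n (z + rowFlip (n + 1))
  simp only [b_eq_zero (hz _), zero_mul, Finset.sum_const_zero, add_zero] at h1
  rw [← h2] at h1
  linear_combination h1 - h3 - h4

lemma dressedU_eq_mono (hN2 : 2 ≤ N2) (n : ZMod N2) :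
    dressedU n = mono (rowFlip (n + 1) : Config N1 N2) fun z => 2 + (rowExp (n + 1) z
      + ∑ j : ZMod N1, b z (lnk n j) * (3 + 2 * b z (vtx n j)
        + 2 * b z (vtx (n + 1) (j + 1)))) := by
  rw [dressedU, mGate_eq_mono, gaugedU_eq_mono, mono_conj]
  refine mono_congr rfl fun z => ?_
  rw [← gaugedExp_eq, ← mExp_add_row hN2]
  ring

lemma add_two_ne {N : ℕ} (hN : 3 ≤ N) (n : ZMod N) : n + 2 ≠ n ∧ n + 2 ≠ n + 1 := by
  have h2 : ((2 : ℕ) : ZMod N).val = 2 := ZMod.val_cast_of_lt (by omega)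
  constructor
  · intro h
    have h3 : (2 : ZMod N) = 0 := by linear_combination h
    rw [Nat.cast_two, h3, ZMod.val_zero] at h2
    omega
  · have h1 := add_one_ne (by omega : 2 ≤ N) (n + 1)
    rwa [add_assoc, one_add_one_eq_two] at h1

lemma xiExp_succ (n : ZMod N2) (z : Config N1 N2) :
    xiExp (n + 1) z = mExp (n + 1) z + ∑ j : ZMod N1,
      (2 * b z (vtx n j) * b z (lnk n j) * b z (vtx (n + 1) (j + 1))
        + b z (vtx n j) * b z (lnk n j) + b z (vtx (n + 1) (j + 1)) * b z (lnk n j)) := by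
  rw [xiExp, add_sub_cancel_right]

lemma xiExp_add_row (hN2 : 3 ≤ N2) (n : ZMod N2) (z : Config N1 N2) :
    xiExp (n + 1) (z + rowFlip (n + 2)) - xiExp (n + 1) z
      = mExp (n + 1) (z + rowFlip (n + 2)) + mExp (n + 1) z := by
  have h1 := (add_two_ne hN2 n).1.symm
  have h2 := (add_two_ne hN2 n).2.symm
  rw [xiExp_succ, xiExp_succ]
  simp only [b_add, b_rowFlip_vtx, b_rowFlip_lnk, h1, h2, if_false, mul_zero, add_zero]
  linear_combination -two_mul_mExp (n + 1) z

/-- The additional `CS` and `CCZ` gates of $\Xi$ vary by the gauge-bit terms with coefficient 1;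
together with the coefficient 3 in `dressedU_eq_mono` they sum to zero modulo 4. -/
lemma xiExp_add_rows (hN2 : 3 ≤ N2) (n : ZMod N2) (z : Config N1 N2) :
    xiExp (n + 1) (z + (rowFlip (n + 1) + rowFlip (n + 2))) - xiExp (n + 1) z
      = rowExp (n + 1) z + rowExp (n + 2) z + ∑ j : ZMod N1,
        b z (lnk n j) * (1 + 2 * b z (vtx n j) + 2 * b z (vtx (n + 1) (j + 1))) := by
  have h1 := (add_two_ne hN2 n).1.symm
  have h2 := (add_two_ne hN2 n).2.symm
  have h3 := (add_one_ne (by omega : 2 ≤ N2) n).symm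
  have h4 := mExp_add_rows (by omega : 2 ≤ N2) (n + 1) z
  rw [add_assoc n, one_add_one_eq_two] at h4
  have h5 : ∑ j : ZMod N1, b z (lnk n j) * (1 + 2 * b z (vtx n j)
      + 2 * b z (vtx (n + 1) (j + 1))) = ∑ j : ZMod N1,
      ((2 * b (z + (rowFlip (n + 1) + rowFlip (n + 2))) (vtx n j)
          * b (z + (rowFlip (n + 1) + rowFlip (n + 2))) (lnk n j)
          * b (z + (rowFlip (n + 1) + rowFlip (n + 2))) (vtx (n + 1) (j + 1))
        + b (z + (rowFlip (n + 1) + rowFlip (n + 2))) (vtx n j)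
          * b (z + (rowFlip (n + 1) + rowFlip (n + 2))) (lnk n j)
        + b (z + (rowFlip (n + 1) + rowFlip (n + 2))) (vtx (n + 1) (j + 1))
          * b (z + (rowFlip (n + 1) + rowFlip (n + 2))) (lnk n j))
      - (2 * b z (vtx n j) * b z (lnk n j) * b z (vtx (n + 1) (j + 1))
        + b z (vtx n j) * b z (lnk n j) + b z (vtx (n + 1) (j + 1)) * b z (lnk n j))) := by
    refine Finset.sum_congr rfl fun j _ => ?_
    simp only [b_add, b_rowFlip_vtx, b_rowFlip_lnk, h1, h2, h3, if_true, if_false]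
    clear * -
    grind
  rw [xiExp_succ, xiExp_succ, h5, ← h4, Finset.sum_sub_distrib]
  linear_combination -two_mul_mExp (n + 1) z

lemma xiGate_dressedU (hN2 : 3 ≤ N2) (n : ZMod N2) :
    xiGate (n + 1) * (dressedU n * levinGu (n + 2)) * xiGateInv (n + 1)
      = (rowX (n + 1) * rowX (n + 2) : Op N1 N2) := by
  have h1 := (add_two_ne hN2 n).1.symm
  have h2 := (add_two_ne hN2 n).2.symm
  rw [dressedU_eq_mono (by omega), levinGu_eq_mono, mono_mul, xiGate_eq_mono, xiGateInv_eq_mono,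
    mono_conj, rowX_eq_mono, rowX_eq_mono, mono_mul]
  refine mono_congr rfl fun z => ?_
  have h3 := xiExp_add_rows hN2 n z
  have h4 := two_mul_rowExp (n + 1) z
  have h5 := two_mul_rowExp (n + 2) z
  have h6 : ∑ j : ZMod N1, b z (lnk n j) * (1 + 2 * b z (vtx n j)
      + 2 * b z (vtx (n + 1) (j + 1))) + ∑ j : ZMod N1, b z (lnk n j) * (3 + 2 * b z (vtx n j)
        + 2 * b z (vtx (n + 1) (j + 1))) = 0 := by
    rw [← Finset.sum_add_distrib]
    refine Finset.sum_eq_zero fun j _ => ?_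
    clear * -
    grind
  simp only [rowExp_add_rowFlip, b_add, b_rowFlip_vtx, b_rowFlip_lnk, h1, h2, if_false, mul_zero,
    add_zero, Pi.zero_apply]
  linear_combination h3 + h4 + h5 + h6 + four_eq_zero

lemma xiGate_levinGu (hN2 : 3 ≤ N2) (n : ZMod N2) :
    xiGate (n + 1) * levinGu (n + 2) * xiGateInv (n + 1)
      = (mGate (n + 1) * levinGu (n + 2) * mGate (n + 1) : Op N1 N2) := by
  rw [levinGu_eq_mono, xiGate_eq_mono, xiGateInv_eq_mono, mGate_eq_mono, mono_conj, mono_conj]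
  refine mono_congr rfl fun z => ?_
  linear_combination xiExp_add_row hN2 n z

lemma mGate_levinGu (hN2 : 2 ≤ N2) (n : ZMod N2) :
    mGate n * (levinGu n * levinGu (n + 1)) * mGate n
      = (rowX n * rowX (n + 1) : Op N1 N2) := by
  rw [levinGu_mul, mGate_eq_mono, mono_conj, rowX_eq_mono, rowX_eq_mono, mono_mul]
  refine mono_congr rfl fun z => ?_
  simp only [Pi.zero_apply, add_zero]
  linear_combination mExp_add_rows hN2 n z + two_mul_rowExp n z + two_mul_rowExp (n + 1) z

/-! ### Gauging is well defined -/

lemma flipX_ket (s z : Config N1 N2) : flipX s (ket z) = ket (z + s) := by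
  rw [flipX_eq_mono, mono_ket]
  simp

lemma gauss_ket (n : ZMod N2) (i : ZMod N1) (z : Config N1 N2) :
    gauss n i (ket z) = ket (z + flipE n i) := by
  rw [gauss_eq_mono, mono_ket]
  simp

lemma not_near_lnk (hN1 : 3 ≤ N1) (n : ZMod N2) (j : ZMod N1) :
    ¬ Near j (lnk n (j + 1) : Site N1 N2) := by
  have h1 := add_one_ne (by omega : 2 ≤ N1) j
  have h2 := (add_two_ne hN1 (j - 1)).1
  rintro (h | h)
  · exact h2 (by linear_combination h)
  · exact h1 h

/-- The gauged form of an operator is unique. -/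
lemma IsGauged.unique (hN1 : 3 ≤ N1) {n : ZMod N2} {j : ZMod N1} {O A B : Op N1 N2}
    (hA : IsGauged n j O A) (hB : IsGauged n j O B) : A = B := by
  have hmove {G : Op N1 N2} (hGA : Commute A G) (hGB : Commute B G) {z : Config N1 N2}
      (h : A (ket z) = B (ket z)) : A (G (ket z)) = B (G (ket z)) := by
    rw [← Module.End.mul_apply, hGA.eq, ← Module.End.mul_apply, hGB.eq, Module.End.mul_apply,
      Module.End.mul_apply, h]
  have hgauss (i : ZMod N1) {z : Config N1 N2} (h : A (ket z) = B (ket z)) :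
      A (ket (z + flipE n i)) = B (ket (z + flipE n i)) := by
    rw [← gauss_ket]
    exact hmove (hA.1 i) (hB.1 i) h
  have hlink {z : Config N1 N2} (h : A (ket z) = B (ket z)) :
      A (ket (z + e (lnk n (j + 1)))) = B (ket (z + e (lnk n (j + 1)))) := by
    rw [← flipX_ket]
    have hn := not_near_lnk hN1 n j
    exact hmove (hA.2.2 _ hn).1 (hB.2.2 _ hn).1 h
  have hsum (I : Finset (ZMod N1)) {z : Config N1 N2} (h : A (ket z) = B (ket z)) :
      A (ket (z + ∑ i ∈ I, flipE n i)) = B (ket (z + ∑ i ∈ I, flipE n i)) := by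
    classical
    induction I using Finset.induction_on with
    | empty => rwa [Finset.sum_empty, add_zero]
    | insert a I ha ih =>
      rw [Finset.sum_insert ha, add_comm (flipE n a), ← add_assoc]
      exact hgauss a ih
  -- On even gauge parity the row is the coboundary of some `h`, so Gauss flips at the support of
  -- `h` reach a trivial gauge field, where `A` and `B` both agree with `O`.
  have heven {z : Config N1 N2} (hz : rowParity n z = 0) : A (ket z) = B (ket z) := by
    obtain ⟨h, hh⟩ := exists_primitive hz
    have key : ∀ i, (z + ∑ k ∈ Finset.univ.filter (fun k => h k = 1), flipE n k) (lnk n i) = 0 := by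
      intro i
      have hind (k : ZMod N1) : (if h k = 1 then (1 : ZMod 2) else 0) = h k := by
        generalize h k = x; revert x; decide
      rw [Pi.add_apply, Finset.sum_apply]
      simp only [flipE_lnk, Finset.sum_add_distrib, Finset.sum_ite_eq, Finset.mem_filter,
        Finset.mem_univ, true_and, hind, hh]
      exact CharTwo.add_self_eq_zero _
    have := hsum (Finset.univ.filter fun k => h k = 1) ((hA.2.1 _ key).trans (hB.2.1 _ key).symm)
    rwa [config_add_add_cancel] at this
  refine ket_ext fun z => ?_
  have hdich : rowParity n z = 0 ∨ rowParity n z = 1 := by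
    generalize rowParity n z = x; revert x; decide
  -- Gauss flips preserve parity, so the odd sector is reached through locality: flipping the link
  -- at `j + 1`, which is not near `j` once $N_1\ge3$, commutes with both operators.
  rcases hdich with hz | hz
  · exact heven hz
  · have h1 : rowParity n (z + e (lnk n (j + 1))) = 0 := by
      rw [rowParity_add, hz]
      have : rowParity n (e (lnk n (j + 1)) : Config N1 N2) = 1 := by
        simp [rowParity, Pi.single_apply]
      rw [this]
      rfl
    have := hlink (heven h1)
    rwa [config_add_add_cancel] at this

lemma gaugingStep_iff (hN1 : 3 ≤ N1) {n : ZMod N2} {j : ZMod N1} {O A : Op N1 N2}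
    (h : IsGauged n j (xiGate n * O * xiGateInv n) A) (O' : Op N1 N2) :
    GaugingStep n j O O' ↔ O' = mGate n * A * mGate n := by
  constructor
  · rintro ⟨A', hA', rfl⟩
    rw [hA'.unique hN1 h]
  · rintro rfl
    exact ⟨A, h, rfl⟩

lemma layeredGauging_succ {n : ZMod N2} {j : ZMod N1} {O A B : Op N1 N2} {r : ℕ}
    (hA : ∀ O', LayeredGauging n j O r O' ↔ O' = A)
    (hB : ∀ O', GaugingStep (n + (r : ZMod N2)) j A O' ↔ O' = B) (O' : Op N1 N2) :
    LayeredGauging n j O (r + 1) O' ↔ O' = B := by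
  constructor
  · rintro ⟨O₁, h1, h2⟩
    rw [hA] at h1
    subst h1
    exact (hB O').1 h2
  · rintro rfl
    exact ⟨A, (hA A).2 rfl, (hB _).2 rfl⟩

lemma isGauged_mono {n : ZMod N2} {j : ZMod N1} {s : Config N1 N2}
    {f g : Config N1 N2 → ZMod 4} (hgauss : ∀ i z, g (z + flipE n i) = g z)
    (hfg : ∀ z : Config N1 N2, (∀ i, z (lnk n i) = 0) → g z = f z)
    (hlocal : ∀ a, ¬ Near j a → s a = 0 ∧ ∀ z, g (z + e a) = g z) :
    IsGauged n j (mono s f) (mono s g) := by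
  refine ⟨fun i => ?_, fun z hz => ?_, fun a ha => ⟨?_, ?_⟩⟩
  · rw [gauss_eq_mono]
    exact mono_commute fun z => by simp [hgauss]
  · rw [mono_ket, mono_ket, hfg z hz]
  · rw [pauliX, flipX_eq_mono]
    exact mono_commute fun z => by simp [(hlocal a ha).2]
  · rw [pauliZ, phase_eq_mono]
    refine mono_commute fun z => ?_
    rw [b_add, b_eq_zero (hlocal a ha).1, add_zero]
    ring

lemma mono_xi_conj (n : ZMod N2) (s : Config N1 N2) (f : Config N1 N2 → ZMod 4) :
    xiGate n * mono s f * xiGateInv n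
      = mono s fun z => -xiExp n z + f z + xiExp n (z + s) := by
  rw [xiGate_eq_mono, xiGateInv_eq_mono, mono_conj]

lemma mono_m_conj (n : ZMod N2) (s : Config N1 N2) (f : Config N1 N2 → ZMod 4) :
    mGate n * mono s f * mGate n = mono s fun z => mExp n z + f z + mExp n (z + s) := by
  rw [mGate_eq_mono, mono_conj]

/-! ### Gauging the Ising term -/

lemma two_val_ext {x y : ZMod 2} (h : x = y) :
    2 * ((x.val : ℕ) : ZMod 4) = 2 * (y.val : ZMod 4) := by
  rw [h]

lemma xi_conj_diag (n : ZMod N2) (f : Config N1 N2 → ZMod 4) :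
    xiGate n * mono 0 f * xiGateInv n = mono 0 f := by
  rw [mono_xi_conj]
  exact mono_congr rfl fun z => by rw [add_zero]; ring

lemma m_conj_diag (n : ZMod N2) (f : Config N1 N2 → ZMod 4) :
    mGate n * mono 0 f * mGate n = mono 0 f := by
  rw [mono_m_conj]
  exact mono_congr rfl fun z => by rw [add_zero]; linear_combination two_mul_mExp n z

/-- The parity of the Ising term of layer `n` gauged with the layer below. -/
def halfFace (n : ZMod N2) (j : ZMod N1) (z : Config N1 N2) : ZMod 2 :=
  z (vtx n j) + z (vtx n (j + 1)) + z (lnk (n - 1) j)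

lemma pauliZ_mul_pauliZ (a c : Site N1 N2) :
    pauliZ a * pauliZ c = mono 0 fun z : Config N1 N2 => 2 * (((z a + z c).val : ℕ) : ZMod 4) := by
  rw [pauliZ, pauliZ, phase_eq_mono, phase_eq_mono, mono_mul]
  refine mono_congr (add_zero _) fun z => ?_
  rw [add_zero, val_cast_add]
  change 2 * b z c + 2 * b z a = 2 * (b z a + b z c + 2 * b z a * b z c)
  linear_combination -b z a * b z c * four_eq_zero

lemma apply_add_e_of_not_near {j : ZMod N1} {a : Site N1 N2} (ha : ¬ Near j a) (z : Config N1 N2)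
    (m : ZMod N2) :
    (z + e a) (vtx m j) = z (vtx m j) ∧ (z + e a) (vtx m (j + 1)) = z (vtx m (j + 1)) ∧
      (z + e a) (vtx m (j - 1)) = z (vtx m (j - 1)) ∧
      (z + e a) (lnk m j) = z (lnk m j) ∧ (z + e a) (lnk m (j - 1)) = z (lnk m (j - 1)) := by
  obtain ⟨k, i⟩ | ⟨k, i⟩ := a
  · simp only [Near, not_or] at ha
    simp [Ne.symm ha.1, Ne.symm ha.2.1, Ne.symm ha.2.2]
  · simp only [Near, not_or] at ha
    simp [Ne.symm ha.1, Ne.symm ha.2]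

lemma isGauged_ising_below (hN2 : 2 ≤ N2) (n : ZMod N2) (j : ZMod N1) :
    IsGauged (n - 1) j (pauliZ (vtx n j) * pauliZ (vtx n (j + 1)))
      (mono 0 fun z => 2 * (((halfFace n j z).val : ℕ) : ZMod 4) : Op N1 N2) := by
  rw [pauliZ_mul_pauliZ]
  refine isGauged_mono (fun i z => two_val_ext ?_) (fun z hz => two_val_ext ?_)
    fun a ha => ⟨rfl, fun z => two_val_ext ?_⟩
  · have h1 := (flipE_vtx hN2 (n - 1) i j).2
    have h2 := (flipE_vtx hN2 (n - 1) i (j + 1)).2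
    rw [sub_add_cancel] at h1 h2
    simp only [halfFace, Pi.add_apply, h1, h2, flipE_lnk]
    generalize (if j = i then (1 : ZMod 2) else 0) = x,
      (if j + 1 = i then (1 : ZMod 2) else 0) = y
    clear * -
    grind
  · rw [halfFace, hz, add_zero]
  · have h (m : ZMod N2) := apply_add_e_of_not_near ha z m
    simp only [halfFace, (h _).1, (h _).2.1, (h _).2.2.2.1]

lemma isGauged_ising_above (n : ZMod N2) (j : ZMod N1) :
    IsGauged n j (mono 0 fun z => 2 * (((halfFace n j z).val : ℕ) : ZMod 4) : Op N1 N2)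
      (SM n j) := by
  rw [SM_eq_mono]
  refine isGauged_mono (fun i z => two_val_ext ?_) (fun z hz => two_val_ext ?_)
    fun a ha => ⟨rfl, fun z => two_val_ext ?_⟩
  · rw [face_add, face_flipE, add_zero]
  · rw [face, hz, add_zero, halfFace]
  · have h (m : ZMod N2) := apply_add_e_of_not_near ha z m
    simp only [face, (h _).1, (h _).2.1, (h _).2.2.2.1]

lemma isGauged_SM (m n : ZMod N2) (j : ZMod N1) :
    IsGauged m j (SM n j : Op N1 N2) (SM n j) := by
  rw [SM_eq_mono]
  refine isGauged_mono (fun i z => two_val_ext ?_) (fun z hz => rfl)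
    fun a ha => ⟨rfl, fun z => two_val_ext ?_⟩
  · rw [face_add, face_flipE, add_zero]
  · have h (m : ZMod N2) := apply_add_e_of_not_near ha z m
    simp only [face, (h _).1, (h _).2.1, (h _).2.2.2.1]

/-- Conjugation by $\Xi$ and $M$ does nothing to diagonal operators. The first step attaches the
gauge qubit below and the second the one above; then $S^M$ commutes with all Gauss operators and is
its own gauged form. -/
lemma layeredGauging_ising (hN1 : 3 ≤ N1) (hN2 : 2 ≤ N2) (n : ZMod N2) (j : ZMod N1) (k : ℕ)
    (O : Op N1 N2) :
    LayeredGauging (n - 1) j (pauliZ (vtx n j) * pauliZ (vtx n (j + 1))) (k + 2) O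
      ↔ O = SM n j := by
  induction k generalizing O with
  | zero =>
    refine layeredGauging_succ (layeredGauging_succ (fun O' => Iff.rfl)
      (B := mono 0 fun z => 2 * (((halfFace n j z).val : ℕ) : ZMod 4)) fun O' => ?_)
      (fun O' => ?_) O
    · rw [Nat.cast_zero, add_zero, pauliZ_mul_pauliZ, gaugingStep_iff hN1, m_conj_diag]
      rw [xi_conj_diag, ← pauliZ_mul_pauliZ]
      exact isGauged_ising_below hN2 n j
    · rw [zero_add, Nat.cast_one, sub_add_cancel, gaugingStep_iff hN1 (A := SM n j), SM_eq_mono,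
        m_conj_diag]
      rw [xi_conj_diag]
      exact isGauged_ising_above n j
  | succ k ih =>
    refine layeredGauging_succ ih (fun O' => ?_) O
    rw [gaugingStep_iff hN1 (A := SM n j), SM_eq_mono, m_conj_diag]
    rw [SM_eq_mono, xi_conj_diag, ← SM_eq_mono]
    exact isGauged_SM _ n j

/-! ### Gauging the Gauss law operators -/

lemma b_flipE_vtx (hN2 : 2 ≤ N2) (n : ZMod N2) (i j : ZMod N1) :
    b (flipE n i) (vtx n j) = (if j = i then 1 else 0) ∧
      b (flipE n i) (vtx (n + 1) j) = if j = i then 1 else 0 := by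
  rw [b, b, (flipE_vtx hN2 n i j).1, (flipE_vtx hN2 n i j).2]
  by_cases h : j = i
  · simp only [h, if_true]
    exact ⟨rfl, rfl⟩
  · simp [h]

lemma b_flipE_vtx_of_ne {n m : ZMod N2} (h : m ≠ n) (h' : m ≠ n + 1) (i j : ZMod N1) :
    b (flipE n i) (vtx m j) = 0 :=
  b_eq_zero (flipE_vtx_of_ne h h' i j)

lemma b_flipE_lnk (hN1 : 2 ≤ N1) (n : ZMod N2) (i j : ZMod N1) :
    b (flipE n i) (lnk n j) = (if j = i then 1 else 0) + if j + 1 = i then 1 else 0 := by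
  have h1 := add_one_ne hN1 j
  rw [b, flipE_lnk]
  by_cases h : j = i
  · subst h
    simp only [h1, if_true, if_false, add_zero]
    rfl
  · by_cases h' : j + 1 = i
    · simp only [h, h', if_true, if_false, zero_add]
      rfl
    · simp [h, h']

lemma b_flipE_lnk_of_ne {n m : ZMod N2} (h : m ≠ n) (i j : ZMod N1) :
    b (flipE n i) (lnk m j) = 0 :=
  b_eq_zero (flipE_lnk_of_ne h i j)

/-- A sum over the columns of terms that involve only the columns `i` and `i + 1`, of which only
column `j` contributes. -/
lemma sum_eq_two_columns (hN1 : 2 ≤ N1) (j : ZMod N1) {F : ZMod N1 → ZMod 4}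
    (h : ∀ i, i ≠ j → i + 1 ≠ j → F i = 0) : ∑ i, F i = F (j - 1) + F j := by
  refine Fintype.sum_eq_add (j - 1) j (sub_one_ne hN1 j) fun i hi => h i hi.2 fun h' => hi.1 ?_
  rw [← h', add_sub_cancel_right]

/-! ### The first gauging step, which couples the Gauss operator to layer $n+2$ -/

lemma mExp_add_flipE (hN1 : 2 ≤ N1) (hN2 : 2 ≤ N2) (n : ZMod N2) (j : ZMod N1)
    (z : Config N1 N2) :
    mExp n (z + flipE n j) + mExp n z
      = 2 * (b z (vtx n (j + 1)) + b z (vtx (n + 1) (j - 1))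
        + b z (vtx n (j - 1)) * b z (vtx (n + 1) (j - 1)) + b z (vtx n j) * b z (vtx n (j + 1))
        + b z (vtx n j) * b z (vtx (n + 1) (j - 1)) + b z (vtx n (j + 1)) * b z (vtx (n + 1) j)
        + b z (vtx n (j + 1)) * b z (vtx (n + 1) (j + 1))
        + b z (vtx (n + 1) (j - 1)) * b z (vtx (n + 1) j)) := by
  have h1 := add_one_ne hN1 j
  have h2 := sub_one_ne hN1 j
  rw [mExp, mExp, ← Finset.sum_add_distrib, sum_eq_two_columns hN1 j]
  · simp only [b_add, (b_flipE_vtx hN2 n j _).1, (b_flipE_vtx hN2 n j _).2, h1, h2,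
      sub_add_cancel, if_true, if_false]
    clear * -
    grind
  · intro i hi hi'
    simp only [b_add, (b_flipE_vtx hN2 n j _).1, (b_flipE_vtx hN2 n j _).2, hi, hi', if_false]
    clear * -
    grind

lemma mExp_succ_add_flipE (hN1 : 2 ≤ N1) (hN2 : 3 ≤ N2) (n : ZMod N2) (j : ZMod N1)
    (z : Config N1 N2) :
    mExp (n + 1) (z + flipE n j) + mExp (n + 1) z
      = 2 * (b z (vtx (n + 1) (j - 1)) * b z (vtx (n + 2) (j - 1))
        + b z (vtx (n + 1) (j + 1)) * b z (vtx (n + 2) j)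
        + b z (vtx (n + 2) (j - 1)) * b z (vtx (n + 2) j)) := by
  have h1 := add_one_ne hN1 j
  have h2 := sub_one_ne hN1 j
  have h3 := add_two_ne hN2 n
  have h4 : n + 1 + 1 = n + 2 := by ring
  rw [mExp, mExp, ← Finset.sum_add_distrib, sum_eq_two_columns hN1 j]
  · simp only [h4, b_add, (b_flipE_vtx (by omega : 2 ≤ N2) n j _).2,
      b_flipE_vtx_of_ne h3.1 h3.2, h1, h2, sub_add_cancel, if_true, if_false]
    clear * -
    grind
  · intro i hi hi'
    simp only [h4, b_add, (b_flipE_vtx (by omega : 2 ≤ N2) n j _).2,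
      b_flipE_vtx_of_ne h3.1 h3.2, hi, hi', if_false]
    clear * -
    grind

/-- The gates of $\Xi_{n+1,n+2}$ at gauge row `n` supply the overall sign and the six `S†` of $S^E$,
with the two diagonal `CZ` gates between `(n, i)` and `(n + 1, i + 1)`. -/
lemma xiExp_succ_add_flipE (hN1 : 2 ≤ N1) (hN2 : 3 ≤ N2) (n : ZMod N2) (j : ZMod N1)
    (z : Config N1 N2) :
    xiExp (n + 1) (z + flipE n j) - xiExp (n + 1) z
      = 2 + 3 * (b z (lnk n (j - 1)) + b z (lnk n j) + b z (vtx n (j - 1)) + b z (vtx n j)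
          + b z (vtx (n + 1) j) + b z (vtx (n + 1) (j + 1)))
        + 2 * (b z (vtx n (j - 1)) * b z (vtx (n + 1) j)
          + b z (vtx n j) * b z (vtx (n + 1) (j + 1)))
        + (mExp (n + 1) (z + flipE n j) + mExp (n + 1) z) := by
  have h1 := add_one_ne hN1 j
  have h2 := sub_one_ne hN1 j
  have key : ∑ i : ZMod N1, ((2 * b (z + flipE n j) (vtx n i) * b (z + flipE n j) (lnk n i)
          * b (z + flipE n j) (vtx (n + 1) (i + 1))
        + b (z + flipE n j) (vtx n i) * b (z + flipE n j) (lnk n i)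
        + b (z + flipE n j) (vtx (n + 1) (i + 1)) * b (z + flipE n j) (lnk n i))
      - (2 * b z (vtx n i) * b z (lnk n i) * b z (vtx (n + 1) (i + 1))
        + b z (vtx n i) * b z (lnk n i) + b z (vtx (n + 1) (i + 1)) * b z (lnk n i)))
      = 2 + 3 * (b z (lnk n (j - 1)) + b z (lnk n j) + b z (vtx n (j - 1)) + b z (vtx n j)
          + b z (vtx (n + 1) j) + b z (vtx (n + 1) (j + 1)))
        + 2 * (b z (vtx n (j - 1)) * b z (vtx (n + 1) j)
          + b z (vtx n j) * b z (vtx (n + 1) (j + 1))) := by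
    rw [sum_eq_two_columns hN1 j]
    · simp only [b_add, (b_flipE_vtx (by omega : 2 ≤ N2) n j _).1,
        (b_flipE_vtx (by omega : 2 ≤ N2) n j _).2, b_flipE_lnk hN1, h1, h2, sub_add_cancel,
        if_true, if_false]
      clear * -
      grind
    · intro i hi hi'
      simp only [b_add, (b_flipE_vtx (by omega : 2 ≤ N2) n j _).1,
        (b_flipE_vtx (by omega : 2 ≤ N2) n j _).2, b_flipE_lnk hN1, hi, hi', if_false]
      clear * -
      grind
  rw [xiExp_succ, xiExp_succ, ← key, Finset.sum_sub_distrib]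
  linear_combination -two_mul_mExp (n + 1) z

/-- The exponent of the Gauss law operator after the first gauging step. -/
def stepExp (n : ZMod N2) (j : ZMod N1) (z : Config N1 N2) : ZMod 4 :=
  2 + 3 * (b z (lnk n (j - 1)) + b z (lnk n j) + b z (lnk (n + 1) j) + b z (vtx n (j - 1))
      + b z (vtx n j) + b z (vtx (n + 1) j) + b z (vtx (n + 1) (j + 1)))
    + 2 * (b z (vtx n (j + 1)) + b z (vtx (n + 1) (j - 1))
      + b z (lnk (n + 1) (j - 1)) * (b z (vtx n (j - 1)) + b z (vtx n j)
        + b z (vtx (n + 1) (j - 1)) + b z (vtx (n + 1) j) + b z (vtx (n + 2) (j - 1))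
        + b z (vtx (n + 2) j))
      + b z (lnk (n + 1) j) * (b z (vtx n j) + b z (vtx n (j + 1)) + b z (vtx (n + 1) (j + 1))
        + b z (vtx (n + 2) j))
      + b z (vtx n (j - 1)) * b z (vtx (n + 1) (j - 1)) + b z (vtx n (j - 1)) * b z (vtx (n + 1) j)
      + b z (vtx n j) * b z (vtx n (j + 1)) + b z (vtx n j) * b z (vtx (n + 1) (j - 1))
      + b z (vtx n j) * b z (vtx (n + 1) (j + 1)) + b z (vtx n (j + 1)) * b z (vtx (n + 1) j)
      + b z (vtx n (j + 1)) * b z (vtx (n + 1) (j + 1))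
      + b z (vtx (n + 1) (j - 1)) * b z (vtx (n + 1) j)
      + b z (vtx (n + 1) (j - 1)) * b z (vtx (n + 2) (j - 1))
      + b z (vtx (n + 1) (j + 1)) * b z (vtx (n + 2) j)
      + b z (vtx (n + 2) (j - 1)) * b z (vtx (n + 2) j))

lemma flipE_of_not_near {j : ZMod N1} {a : Site N1 N2} (ha : ¬ Near j a) (n : ZMod N2) :
    flipE n j a = 0 := by
  obtain ⟨k, i⟩ | ⟨k, i⟩ := a
  · simp only [Near, not_or] at ha
    simp [flipE, ha.2.1]
  · simp only [Near, not_or] at ha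
    simp [flipE, ha.1, ha.2]

lemma b_add_e_of_not_near {j : ZMod N1} {a : Site N1 N2} (ha : ¬ Near j a) (z : Config N1 N2)
    (m : ZMod N2) :
    b (z + e a) (vtx m j) = b z (vtx m j) ∧ b (z + e a) (vtx m (j + 1)) = b z (vtx m (j + 1)) ∧
      b (z + e a) (vtx m (j - 1)) = b z (vtx m (j - 1)) ∧
      b (z + e a) (lnk m j) = b z (lnk m j) ∧
      b (z + e a) (lnk m (j - 1)) = b z (lnk m (j - 1)) := by
  obtain ⟨h1, h2, h3, h4, h5⟩ := apply_add_e_of_not_near ha z m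
  simp only [b, h1, h2, h3, h4, h5, and_self]

lemma stepExp_add_flipE (hN1 : 2 ≤ N1) (hN2 : 4 ≤ N2) (n : ZMod N2) (i j : ZMod N1)
    (z : Config N1 N2) : stepExp n j (z + flipE (n + 1) i) = stepExp n j z := by
  have h1 := add_one_ne hN1 j
  have h2 := sub_one_ne hN1 j
  have h3 := (add_one_ne (by omega : 2 ≤ N2) n).symm
  have h4 := (add_two_ne (by omega : 3 ≤ N2) n).1.symm
  have h5 : n + 1 + 1 = n + 2 := by ring
  rw [← h5] at h4
  have hv (c : ZMod N1) : b (flipE (n + 1) i) (vtx (n + 2) c) = if c = i then 1 else 0 := by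
    rw [← h5]
    exact (b_flipE_vtx (by omega) (n + 1) i c).2
  simp only [stepExp, b_add, b_flipE_vtx_of_ne h3 h4, b_flipE_lnk_of_ne h3,
    (b_flipE_vtx (by omega : 2 ≤ N2) (n + 1) i _).1, hv, b_flipE_lnk hN1, sub_add_cancel]
  by_cases hj : j = i
  · have h6 : ¬ j + 1 = i := hj ▸ h1
    have h7 : ¬ j - 1 = i := hj ▸ h2
    simp only [hj, if_true]
    rw [← hj]
    simp only [h1, h2, if_false]
    clear * -
    grind
  · simp only [hj, if_false]
    by_cases h6 : j + 1 = i <;> by_cases h7 : j - 1 = i <;>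
      simp only [h6, h7, if_true, if_false] <;> clear * - <;> grind

lemma isGauged_xi_conj_gauss (hN1 : 3 ≤ N1) (hN2 : 4 ≤ N2) (n : ZMod N2) (j : ZMod N1) :
    IsGauged (n + 1) j (xiGate (n + 1) * (mGate n * gauss n j * mGate n) * xiGateInv (n + 1))
      (mono (flipE n j) (stepExp n j) : Op N1 N2) := by
  rw [gauss_eq_mono, mono_m_conj, mono_xi_conj]
  refine isGauged_mono (fun i z => stepExp_add_flipE (by omega) hN2 n i j z) (fun z hz => ?_)
    fun a ha => ⟨flipE_of_not_near ha n, fun z => ?_⟩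
  · have h1 := mExp_add_flipE (by omega) (by omega) n j z
    have h2 := mExp_succ_add_flipE (by omega) (by omega) n j z
    have h3 := xiExp_succ_add_flipE (by omega) (by omega) n j z
    simp only [stepExp, b_eq_zero (hz _), Pi.zero_apply]
    linear_combination -h1 - h2 - h3
  · have h (m : ZMod N2) := b_add_e_of_not_near ha z m
    simp only [stepExp, (h _).1, (h _).2.1, (h _).2.2.1, (h _).2.2.2.1, (h _).2.2.2.2]

/-! ### The second gauging step, which yields $S^E$ -/

lemma add_natCast_ne {a c : ℕ} (ha : a < N2) (hc : c < N2) (hac : a ≠ c) (n : ZMod N2) :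
    n + (a : ZMod N2) ≠ n + (c : ZMod N2) := by
  intro h
  have h1 := congrArg ZMod.val (add_left_cancel h)
  rw [ZMod.val_cast_of_lt ha, ZMod.val_cast_of_lt hc] at h1
  exact hac h1

lemma mExp_add_flipE_of_ne {n m : ZMod N2} (h1 : m ≠ n) (h2 : m ≠ n + 1) (h3 : m + 1 ≠ n)
    (h4 : m + 1 ≠ n + 1) (j : ZMod N1) (z : Config N1 N2) :
    mExp m (z + flipE n j) = mExp m z := by
  simp only [mExp, b_add, b_flipE_vtx_of_ne h1 h2, b_flipE_vtx_of_ne h3 h4, mul_zero, add_zero]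

lemma xiExp_two_add_flipE (hN1 : 2 ≤ N1) (hN2 : 4 ≤ N2) (n : ZMod N2) (j : ZMod N1)
    (z : Config N1 N2) :
    xiExp (n + 2) (z + flipE n j) - xiExp (n + 2) z
      = (1 + 2 * b z (vtx (n + 1) j))
        * (b z (lnk (n + 1) j) * (1 + 2 * b z (vtx (n + 2) (j + 1)))) := by
  have h2 := sub_one_ne hN1 j
  have h3 := add_two_ne (by omega : 3 ≤ N2) n
  have h4 := add_one_ne (by omega : 2 ≤ N2) n
  have h5 := add_natCast_ne (show 3 < N2 by omega) (show 0 < N2 by omega) (by omega) n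
  have h6 := add_natCast_ne (show 3 < N2 by omega) (show 1 < N2 by omega) (by omega) n
  have h7 : n + 2 + 1 = n + ((3 : ℕ) : ZMod N2) := by push_cast; ring
  rw [Nat.cast_zero, add_zero, ← h7] at h5
  rw [Nat.cast_one, ← h7] at h6
  have h8 : n + 2 = n + 1 + 1 := by ring
  have key : ∑ i : ZMod N1,
      ((2 * b (z + flipE n j) (vtx (n + 1) i) * b (z + flipE n j) (lnk (n + 1) i)
          * b (z + flipE n j) (vtx (n + 2) (i + 1))
        + b (z + flipE n j) (vtx (n + 1) i) * b (z + flipE n j) (lnk (n + 1) i)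
        + b (z + flipE n j) (vtx (n + 2) (i + 1)) * b (z + flipE n j) (lnk (n + 1) i))
      - (2 * b z (vtx (n + 1) i) * b z (lnk (n + 1) i) * b z (vtx (n + 2) (i + 1))
        + b z (vtx (n + 1) i) * b z (lnk (n + 1) i)
        + b z (vtx (n + 2) (i + 1)) * b z (lnk (n + 1) i)))
      = (1 + 2 * b z (vtx (n + 1) j))
        * (b z (lnk (n + 1) j) * (1 + 2 * b z (vtx (n + 2) (j + 1)))) := by
    rw [sum_eq_two_columns hN1 j]
    · simp only [b_add, (b_flipE_vtx (by omega : 2 ≤ N2) n j _).2, b_flipE_vtx_of_ne h3.1 h3.2,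
        b_flipE_lnk_of_ne h4, h2, if_true, if_false]
      clear * -
      grind
    · intro i hi hi'
      simp only [b_add, (b_flipE_vtx (by omega : 2 ≤ N2) n j _).2, b_flipE_vtx_of_ne h3.1 h3.2,
        b_flipE_lnk_of_ne h4, hi, if_false]
      clear * -
      grind
  have h9 := mExp_add_flipE_of_ne h3.1 h3.2 h5 h6 j z
  rw [h8] at key h9 ⊢
  rw [xiExp_succ, xiExp_succ, h9, ← key, Finset.sum_sub_distrib]
  ring

lemma expE_add_flipE_two (hN1 : 2 ≤ N1) (hN2 : 4 ≤ N2) (n : ZMod N2) (i j : ZMod N1)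
    (z : Config N1 N2) : expE n j (z + flipE (n + 2) i) = expE n j z := by
  have hne {a : ℕ} (ha : a < 2) (c : ℕ) (hc : c < 4) (hac : a ≠ c) :=
    add_natCast_ne (N2 := N2) (show a < N2 by omega) (show c < N2 by omega) hac n
  have h1 : n ≠ n + 2 := by simpa using hne (a := 0) (by omega) 2 (by omega) (by omega)
  have h2 : n ≠ n + 2 + 1 := by
    have := hne (a := 0) (by omega) 3 (by omega) (by omega)
    rw [Nat.cast_zero, add_zero] at this
    convert this using 1
    push_cast
    ring
  have h3 : n + 1 ≠ n + 2 := by simpa using hne (a := 1) (by omega) 2 (by omega) (by omega)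
  have h4 : n + 1 ≠ n + 2 + 1 := by
    have := hne (a := 1) (by omega) 3 (by omega) (by omega)
    rw [Nat.cast_one] at this
    convert this using 1
    push_cast
    ring
  simp only [expE_eq, b_add, b_flipE_vtx_of_ne h1 h2, b_flipE_vtx_of_ne h3 h4,
    b_flipE_lnk_of_ne h1, b_flipE_lnk_of_ne h3, (b_flipE_vtx (by omega : 2 ≤ N2) (n + 2) i _).1,
    b_flipE_lnk hN1, sub_add_cancel]
  clear * -
  grind

/-- Conjugation by $M_{n+1,n+2}$ cancels the three matter `CZ` gates of `stepExp` that involve layer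
`n + 2`. Conjugation by $\Xi_{n+2,n+3}$ cancels its `S†` on `lnk (n + 1) j` and adds the two missing
`CZ` partners of that link. Gauging then supplies the `CZ` gates between the links of rows `n + 1`
and `n + 2`. -/
lemma isGauged_xi_conj_stepExp (hN1 : 3 ≤ N1) (hN2 : 4 ≤ N2) (n : ZMod N2) (j : ZMod N1) :
    IsGauged (n + 2) j (xiGate (n + 2)
        * (mGate (n + 1) * mono (flipE n j) (stepExp n j) * mGate (n + 1)) * xiGateInv (n + 2))
      (SE n j : Op N1 N2) := by
  rw [SE_eq_mono, mono_m_conj, mono_xi_conj]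
  refine isGauged_mono (fun i z => expE_add_flipE_two (by omega) hN2 n i j z) (fun z hz => ?_)
    fun a ha => ⟨flipE_of_not_near ha n, fun z => ?_⟩
  · have h1 := mExp_succ_add_flipE (by omega) (by omega) n j z
    have h2 := xiExp_two_add_flipE (by omega) hN2 n j z
    have key : expE n j z = stepExp n j z
        + 2 * (b z (vtx (n + 1) (j - 1)) * b z (vtx (n + 2) (j - 1))
        + b z (vtx (n + 1) (j + 1)) * b z (vtx (n + 2) j)
        + b z (vtx (n + 2) (j - 1)) * b z (vtx (n + 2) j))
        + (1 + 2 * b z (vtx (n + 1) j))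
          * (b z (lnk (n + 1) j) * (1 + 2 * b z (vtx (n + 2) (j + 1)))) := by
      rw [expE_eq]
      simp only [stepExp, b_eq_zero (hz _)]
      clear *-
      grind
    rw [key]
    linear_combination -h1 - h2
  · have h (m : ZMod N2) := b_add_e_of_not_near ha z m
    simp only [expE_eq, (h _).1, (h _).2.1, (h _).2.2.1, (h _).2.2.2.1, (h _).2.2.2.2]

/-! ### The later gauging steps, which leave $S^E$ unchanged -/

lemma m_conj_SE {m n : ZMod N2} (h1 : m ≠ n) (h2 : m ≠ n + 1) (h3 : m + 1 ≠ n)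
    (h4 : m + 1 ≠ n + 1) (j : ZMod N1) : mGate m * SE n j * mGate m = (SE n j : Op N1 N2) := by
  rw [SE_eq_mono, mono_m_conj]
  refine mono_congr rfl fun z => ?_
  rw [mExp_add_flipE_of_ne h1 h2 h3 h4]
  linear_combination two_mul_mExp m z

lemma xi_conj_SE {m n : ZMod N2} (h1 : m + 1 ≠ n) (h2 : m + 1 ≠ n + 1) (h3 : m + 1 + 1 ≠ n)
    (h4 : m + 1 + 1 ≠ n + 1) (h5 : m ≠ n) (h6 : m ≠ n + 1) (j : ZMod N1) :
    xiGate (m + 1) * SE n j * xiGateInv (m + 1) = (SE n j : Op N1 N2) := by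
  rw [SE_eq_mono, mono_xi_conj]
  refine mono_congr rfl fun z => ?_
  have h : xiExp (m + 1) (z + flipE n j) = xiExp (m + 1) z := by
    rw [xiExp_succ, xiExp_succ, mExp_add_flipE_of_ne h1 h2 h3 h4]
    simp only [b_add, b_flipE_vtx_of_ne h5 h6, b_flipE_vtx_of_ne h1 h2, b_flipE_lnk_of_ne h5,
      mul_zero, add_zero]
  rw [h]
  ring

lemma isGauged_SE {m n : ZMod N2} (h0 : n ≠ m) (h1 : n + 1 ≠ m) (h2 : n + 2 ≠ m)
    (h3 : n ≠ m + 1) (h4 : n + 1 ≠ m + 1) (h5 : n + 2 ≠ m + 1) (j : ZMod N1) :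
    IsGauged m j (SE n j : Op N1 N2) (SE n j) := by
  rw [SE_eq_mono]
  refine isGauged_mono (fun i z => ?_) (fun z hz => rfl)
    fun a ha => ⟨flipE_of_not_near ha n, fun z => ?_⟩
  · simp only [expE_eq, b_add, b_flipE_vtx_of_ne h0 h3, b_flipE_vtx_of_ne h1 h4,
      b_flipE_vtx_of_ne h2 h5, b_flipE_lnk_of_ne h0, b_flipE_lnk_of_ne h1, b_flipE_lnk_of_ne h2,
      mul_zero, add_zero]
  · have h (m : ZMod N2) := b_add_e_of_not_near ha z m
    simp only [expE_eq, (h _).1, (h _).2.1, (h _).2.2.1, (h _).2.2.2.1, (h _).2.2.2.2]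

/-- The bound `k + 5 ≤ N2` keeps the layers `n + k + 3` and `n + k + 4` of this step from wrapping
around to the layers `n`, `n + 1`, `n + 2` on which $S^E$ acts. -/
lemma gaugingStep_SE (hN1 : 3 ≤ N1) {k : ℕ} (hk : k + 5 ≤ N2) (n : ZMod N2) (j : ZMod N1)
    (O : Op N1 N2) :
    GaugingStep (n + 1 + ((k + 2 : ℕ) : ZMod N2)) j (SE n j) O ↔ O = SE n j := by
  -- $\Xi$ also acts on the matter and gauge qubits one layer below its pair, so `xi_conj_SE` is
  -- indexed by that lower layer.
  have hm : n + 1 + ((k + 2 : ℕ) : ZMod N2) = n + ((k + 2 : ℕ) : ZMod N2) + 1 := by ring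
  have hne {a c : ℕ} (ha : a ≤ 2) (hc : 2 ≤ c) (hc' : c ≤ k + 4) (hac : a ≠ c) :
      n + (a : ZMod N2) ≠ n + (c : ZMod N2) :=
    add_natCast_ne (show a < N2 by omega) (show c < N2 by omega) hac n
  have e1 : n + ((k + 2 : ℕ) : ZMod N2) + 1 = n + ((k + 3 : ℕ) : ZMod N2) := by push_cast; ring
  have e2 : n + ((k + 3 : ℕ) : ZMod N2) + 1 = n + ((k + 4 : ℕ) : ZMod N2) := by push_cast; ring
  have e3 : n = n + ((0 : ℕ) : ZMod N2) := by simp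
  have e4 : n + 1 = n + ((1 : ℕ) : ZMod N2) := by simp
  have e5 : n + 2 = n + ((2 : ℕ) : ZMod N2) := by simp
  have f0 {c : ℕ} (hc : 2 ≤ c) (hc' : c ≤ k + 4) : n ≠ n + (c : ZMod N2) := by
    simpa using hne (a := 0) (by omega) hc hc' (by omega)
  have f1 {c : ℕ} (hc : 2 ≤ c) (hc' : c ≤ k + 4) : n + 1 ≠ n + (c : ZMod N2) := by
    simpa using hne (a := 1) (by omega) hc hc' (by omega)
  have f2 {c : ℕ} (hc : 3 ≤ c) (hc' : c ≤ k + 4) : n + 2 ≠ n + (c : ZMod N2) := by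
    simpa using hne (a := 2) (by omega) (by omega) hc' (by omega)
  rw [hm, gaugingStep_iff hN1 (A := SE n j), m_conj_SE]
  · rw [e1]; exact (f0 (by omega) (by omega)).symm
  · rw [e1]; exact (f1 (by omega) (by omega)).symm
  · rw [e1, e2]; exact (f0 (by omega) (by omega)).symm
  · rw [e1, e2]; exact (f1 (by omega) (by omega)).symm
  · rw [xi_conj_SE]
    · rw [e1]
      refine isGauged_SE ?_ ?_ ?_ ?_ ?_ ?_ j
      · exact f0 (by omega) (by omega)
      · exact f1 (by omega) (by omega)
      · exact f2 (by omega) (by omega)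
      · rw [e2]; exact f0 (by omega) (by omega)
      · rw [e2]; exact f1 (by omega) (by omega)
      · rw [e2]; exact f2 (by omega) (by omega)
    · rw [e1]; exact (f0 (by omega) (by omega)).symm
    · rw [e1]; exact (f1 (by omega) (by omega)).symm
    · rw [e1, e2]; exact (f0 (by omega) (by omega)).symm
    · rw [e1, e2]; exact (f1 (by omega) (by omega)).symm
    · exact (f0 (by omega) (by omega)).symm
    · exact (f1 (by omega) (by omega)).symm

lemma layeredGauging_gauss (hN1 : 3 ≤ N1) (n : ZMod N2) (j : ZMod N1) (k : ℕ)
    (hk : k + 4 ≤ N2) (O : Op N1 N2) :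
    LayeredGauging (n + 1) j (mGate n * gauss n j * mGate n) (k + 2) O ↔ O = SE n j := by
  induction k generalizing O with
  | zero =>
    have h3 := add_two_ne (by omega : 3 ≤ N2) n
    have h4 := (add_two_ne (by omega : 3 ≤ N2) (n + 1)).2
    have h5 : n + 2 + 1 = n + 1 + 2 := by ring
    have h6 := add_natCast_ne (show 3 < N2 by omega) (show 0 < N2 by omega) (by omega) n
    have h7 : n + ((3 : ℕ) : ZMod N2) = n + 2 + 1 := by push_cast; ring
    have h8 := (add_two_ne (by omega : 3 ≤ N2) (n + 1)).1
    rw [Nat.cast_zero, add_zero, h7] at h6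
    refine layeredGauging_succ (layeredGauging_succ (fun O' => Iff.rfl)
      (B := mGate (n + 1) * mono (flipE n j) (stepExp n j) * mGate (n + 1)) fun O' => ?_)
      (fun O' => ?_) O
    · rw [Nat.cast_zero, add_zero]
      exact gaugingStep_iff hN1 (isGauged_xi_conj_gauss hN1 (by omega) n j) O'
    · rw [zero_add, Nat.cast_one, add_assoc n, one_add_one_eq_two,
        gaugingStep_iff hN1 (isGauged_xi_conj_stepExp hN1 (by omega) n j),
        m_conj_SE h3.1 h3.2 h6 (h5 ▸ h8)]
  | succ k ih => exact layeredGauging_succ (ih (by omega)) (gaugingStep_SE hN1 hk n j) O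

end DoubleSemion

theorem mainTheorem2 (N1 N2 : ℕ) [NeZero N1] [NeZero N2] (hN1 : 2 ≤ N1) (hN2 : 2 ≤ N2) :
    -- the stabilizers are those obtained by layered gauging of the Levin-Gu symmetry
    (3 ≤ N1 → 4 ≤ N2 →
      (∀ n : ZMod N2,
        mGate n * (levinGu n * levinGu (n + 1))
            * mGate n
          = (rowX n * rowX (n + 1) : Op N1 N2)
        ∧ (∀ j : ZMod N1, Commute (gaugedU n) (gauss n j))
        ∧ (∀ z : Config N1 N2, (∀ j : ZMod N1, z (lnk n j) = 0) →
            gaugedU n (ket z)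
              = (mGate n * levinGu (n + 1) * mGate n : Op N1 N2)
                  (ket z))
        ∧ xiGate (n + 1) * (dressedU n * levinGu (n + 2))
            * xiGateInv (n + 1)
          = (rowX (n + 1) * rowX (n + 2) : Op N1 N2)
        ∧ xiGate (n + 1) * levinGu (n + 2)
            * xiGateInv (n + 1)
          = (mGate (n + 1) * levinGu (n + 2)
              * mGate (n + 1) : Op N1 N2))
      ∧ (∀ (n : ZMod N2) (j : ZMod N1) (r : ℕ) (O : Op N1 N2),
          2 ≤ r → r + 2 ≤ N2 →
          (LayeredGauging (n + 1) j
              (mGate n * gauss n j * mGate n) r O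
            ↔ O = SE n j))
      ∧ (∀ (n : ZMod N2) (j : ZMod N1) (r : ℕ) (O : Op N1 N2),
          2 ≤ r → r + 1 ≤ N2 →
          (LayeredGauging (n - 1) j
              (pauliZ (vtx n j)
                * pauliZ (vtx n (j + 1))) r O
            ↔ O = SM n j)))
    -- the stabilizers are Hermitian involutions that commute with each other
    ∧ (∀ (n : ZMod N2) (j : ZMod N1),
        (SE n j : Op N1 N2).IsSymmetric
        ∧ (SE n j : Op N1 N2) ^ 2 = 1
        ∧ (SM n j : Op N1 N2).IsSymmetric
        ∧ (SM n j : Op N1 N2) ^ 2 = 1)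
    ∧ (∀ (n n' : ZMod N2) (j j' : ZMod N1),
        Commute (SE n j) (SE n' j')
        ∧ Commute (SE n j) (SM n' j')
        ∧ Commute (SM n j) (SM n' j'))
    -- the product of all `S^E` is the identity
    ∧ prodAll (SE : ZMod N2 → ZMod N1 → Op N1 N2) = 1
    -- no frustration: the ground states are exactly the states that satisfy all stabilizers
    ∧ IsLeast (energies (hamTilde N1 N2)
        (gaussSpace N1 N2)) (-((N1 : ℝ) * N2))
    ∧ energySpace (hamTilde N1 N2) (gaussSpace N1 N2)
        (-((N1 : ℝ) * N2)) = stabSpace N1 N2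
    ∧ IsLeast (energies (ham N1 N2) ⊤) (-(2 * (N1 : ℝ) * N2))
    ∧ energySpace (ham N1 N2) ⊤ (-(2 * (N1 : ℝ) * N2))
        = stabSpace N1 N2
    -- exactly four ground states, labelled by the non-contractible loops
    ∧ Module.finrank ℂ (stabSpace N1 N2) = 4
    ∧ (∀ (n₀ : ZMod N2) (j₀ : ZMod N1),
        LinearIndependent ℂ (loopState n₀ j₀)
        ∧ Submodule.span ℂ (Set.range (loopState n₀ j₀))
          = stabSpace N1 N2)
    -- the energy gap, bounded below independently of the size
    ∧ (∀ E ∈ energies (hamTilde N1 N2) (gaussSpace N1 N2),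
        E ≠ -((N1 : ℝ) * N2) → -((N1 : ℝ) * N2) + 2 ≤ E)
    ∧ (∀ E ∈ energies (ham N1 N2) ⊤,
        E ≠ -(2 * (N1 : ℝ) * N2) → -(2 * (N1 : ℝ) * N2) + 2 ≤ E) := by
  refine ⟨fun h3 h4 => ⟨fun n => ⟨mGate_levinGu hN2 n, gaugedU_commute_gauss hN2 n,
      fun z hz => gaugedU_ket hN2 n hz, xiGate_dressedU (by omega) n, xiGate_levinGu (by omega) n⟩,
      fun n j r O hr hr' => ?_, fun n j r O hr _ => ?_⟩,
    fun n j => ⟨?_, (pow_two _).trans (SE_mul_self hN1 hN2 n j), ?_,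
      (pow_two _).trans (SM_mul_self n j)⟩,
    fun n n' j j' => ⟨SE_commute hN1 hN2 n n' j j', SE_commute_SM n n' j j', SM_commute n n' j j'⟩,
    prodAll_SE hN1 hN2, (energies_hamTilde hN1 hN2).1, (energies_hamTilde hN1 hN2).2.1,
    (energies_ham hN1 hN2).1, (energies_ham hN1 hN2).2.1, finrank_stabSpace hN1 hN2,
    fun n₀ j₀ => ⟨linearIndependent_loopState hN1 hN2 n₀ j₀, span_loopState hN1 hN2 n₀ j₀⟩,
    (energies_hamTilde hN1 hN2).2.2, (energies_ham hN1 hN2).2.2⟩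
  · obtain ⟨k, rfl⟩ := Nat.exists_eq_add_of_le' hr
    exact layeredGauging_gauss h3 n j k (by omega) O
  · obtain ⟨k, rfl⟩ := Nat.exists_eq_add_of_le' hr
    exact layeredGauging_ising h3 hN2 n j k O
  · have h := (pow_two _).trans (SE_mul_self hN1 hN2 n j)
    rw [SE_eq_mono] at h ⊢
    exact mono_isSymmetric h
  · have h := (pow_two _).trans (SM_mul_self n j)
    rw [SM_eq_mono] at h ⊢
    exact mono_isSymmetric h
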